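/- **Setting.** Let $G=(V,E)$ be a finite simple undirected graph with edge weights $w(e)\ge 0$, and let $A,B,C\subset V$ be pairwise disjoint sets (the boundary vertices are $A\sqcup B\sqcup C$). Let $n\ge 2$ be an integer and $m\ge 2$ an even integer. For $S,T\subset V$ let $\mu(S:T)$ be the set of edges which have some vertex in $S$ and some vertex in $T$, let $\mu(S)=\mu(S:S^c)$, and $w(F)=\sum_{e\in F}w(e)$ for $F\subset E$. **Permutations and partitions.** Let $S_{mn}$ be the symmetric group on the pairs $(k,\ell)$, $1\le k\le n$, $1\le\ell\le m$. Let $g_B:(k,\ell)\mapsto(k,\ell+1)$ (cyclically in $\ell$), let $\gamma$ be the permutation $(k,\ell)\mapsto(k+1,\ell)$ (cyclically in $k$) for $\ell>m/2$ and $(k,\ell)\mapsto(k,\ell)$ for $\ell\le m/2$, let $g_A=\gamma^{-1}g_B\gamma$, and let $X$ be the permutation which, for every $k$, permutes $(k,1),\dots,(k,m/2)$ cyclically and permutes $(k,m/2+1),\dots,(k,m)$ cyclically, in increasing order of $\ell$. On $S_{mn}$ let $d(g,g')=mn-\#(gg'^{-1})$, where $\#$ is the number of cycles (fixed points included). For partitions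 $p,p'$ of a finite set let $d(p,p')=\#(p)+\#(p')-2\#(p\vee p')$, where $\#$ is the number of blocks and $\vee$ is the join (least upper bound when finer partitions are smaller). Let $P(g)$ be the partition into the cycles of $g$, let $P_{2n}$ be the set of partitions of the set of the $2n$ blocks of $P(X)$, let $\mathrm{id}\in P_{2n}$ be its finest element, and let $q_X(g)\in P_{2n}$ be the partition induced by $P(g)\vee P(X)$ on the blocks of $P(X)$. On $B_{2n}=\{0,1\}^{2n}$ let $d$ be the Hamming distance. **Programs.** For $S,T\subset V$ let $\mathcal P_{S,T}$ be the set of walks in $G$ from a vertex of $S$ to a vertex of $T$ (edges and vertices may be repeated); for a function $f$ on $E$ and a walk $L$ let $f(L)=\sum_{e\in L}f(e)$, where every edge is counted as often as it is traversed. * $R=\min_g R(g)$ with $R(g)=\sum_{e=\{x,y\}\in E}w(e)\,d(g(x),g(y))$, over all $g:V\to S_{mn}$ with $g=g_A$ on $A$, $g=g_B$ on $B$, $g=\mathrm{id}$ on $C$. * $Q=\min_q\sum_{e=\{x,y\}\in E}w(e)\,d(q(x),q(y))$, over all $q:V\to P_{2n}$ with $q=q_X(g_A)$ on $A$, $q=q_X(g_B)$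 on $B$, $q=\mathrm{id}$ on $C$. * $B=\min_b B(b)$, over all $b:V\to B_{2n}$ with $b=11\dots1$ on $A\cup B$ and $b=00\dots0$ on $C$, where $B(b)=\min_r\sum_{e\in E}w(e)r(e)$ over all $r:E\to\mathbb Z_{\ge0}$ with $r(e)\ge\lceil\tfrac12 d(b(x),b(y))\rceil$ for every $e=\{x,y\}\in E$ and $r(L)\in 2(n-\delta_L)+2\mathbb Z_{\ge0}$ for every $L\in\mathcal P_{A,B}$; here $\delta_L=1$ if the bitwise "and" of $b(v)$ over all vertices $v$ of $L$ is $11\dots1$, and $\delta_L=0$ otherwise. * $I=\min_{\rho,\sigma}\sum_{e\in E}w(e)(\sigma(e)+\rho(e))$, over all $\rho,\sigma:E\to\mathbb Z_{\ge0}$ with $(\sigma+\rho)(L)\in 2(n-\delta_{\rho(L),0})+2\mathbb Z_{\ge0}$ for every $L\in\mathcal P_{A,B}$ and $\rho(L)\ge n$ for every $L\in\mathcal P_{A\cup B,C}$. * $\mathcal A(AB:C)=\min_r w(\mu(r))$, over all $r\subset V$ with $A\cup B\subset r$ and $C\subset r^c$. * $\mathcal A_{\mathbf t}(A:B:C)=\min\big[\,2(n-1)\,w(\mu(\alpha:\beta))+n\,w(\mu(\beta:\gamma))+n\,w(\mu(\gamma:\alpha))\big]$,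 the triway cut with tensions $(t_{A:B},t_{B:C},t_{C:A})=(2(n-1),n,n)$, over all $V=\alpha\sqcup\beta\sqcup\gamma$ with $A\subset\alpha$, $B\subset\beta$, $C\subset\gamma$. **Theorem.** All these minima are attained (including $B(b)$ for every admissible $b$), and $$R-n(m-2)\,\mathcal A(AB:C)=Q=B=I=\mathcal A_{\mathbf t}(A:B:C).$$ Moreover, let $r_C$ be any minimal cut for $C:AB$, that is, a set with $C\subset r_C\subset V\setminus(A\cup B)$ for which $w(\mu(r_C))$ is minimal. Then there is a minimal triway cut $(\alpha,\beta,\gamma)$ with $r_C\subset\gamma$, and for every such triway cut the configuration $$g(x)=\begin{cases}g_A,&x\in\alpha\\ g_B,&x\in\beta\\ \mathrm{id},&x\in r_C\\ X,&x\in\gamma\setminus r_C\end{cases}$$ satisfies the boundary conditions of $R$ and attains the minimum, $R(g)=R$. -/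

import Mathlib

namespace TriwayCut

/-! ### Set partitions and permutations

A partition of a finite set `α` is a `Setoid α`; the order is refinement (finer ≤ coarser), so `⊔` is
the join of partitions and `⊥` is the partition into singletons. -/

/-- The number of blocks of a partition. -/
noncomputable def blocks {α : Type*} (p : Setoid α) : ℕ := Nat.card (Quotient p)

/-- The distance `#(p) + #(q) - 2 #(p ∨ q)` of partitions. -/
noncomputable def partitionDist {α : Type*} (p q : Setoid α) : ℤ :=
  (blocks p : ℤ) + blocks q - 2 * blocks (p ⊔ q)

/-- The partition `P(g)` into the cycles (fixed points included) of a permutation. -/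
def cyclePartition {α : Type*} (g : Equiv.Perm α) : Setoid α := Equiv.Perm.SameCycle.setoid g

/-- The Cayley distance `N - #(g h⁻¹)` on the symmetric group of a set with `N` elements. -/
noncomputable def cayleyDist {α : Type*} (g h : Equiv.Perm α) : ℤ :=
  (Nat.card α : ℤ) - blocks (cyclePartition (g * h⁻¹))

/-- The partition `q_{g₀}(g) = (P(g) ∨ P(g₀)) / ∼` of the set of blocks of `P(g₀)`. -/
def coarsen {α : Type*} (g₀ g : Equiv.Perm α) : Setoid (Quotient (cyclePartition g₀)) :=
  Setoid.mapOfSurjective (cyclePartition g ⊔ cyclePartition g₀) (Quotient.mk (cyclePartition g₀))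
    (by
      intro x y h
      exact (le_sup_right : cyclePartition g₀ ≤ cyclePartition g ⊔ cyclePartition g₀)
        (Quotient.exact h))
    Quotient.mk_surjective

theorem partitionDist_comm {α : Type*} (p q : Setoid α) : partitionDist p q = partitionDist q p := by
  unfold partitionDist
  rw [sup_comm]
  ring

theorem cayleyDist_comm {α : Type*} (g h : Equiv.Perm α) : cayleyDist g h = cayleyDist h g := by
  have key : cyclePartition (g * h⁻¹) = cyclePartition (h * g⁻¹) := by
    ext x y
    change (g * h⁻¹).SameCycle x y ↔ (h * g⁻¹).SameCycle x y
    rw [← Equiv.Perm.sameCycle_inv (f := h * g⁻¹)]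
    simp
  unfold cayleyDist
  rw [key]

/-! ### The boundary permutations

The `m * n` replicas are labelled by pairs `(k, ℓ)` in `Fin n × Fin m`. The indices start at `0`, so
the upper half of a circle consists of the `ℓ < m / 2`. -/

/-- The symmetric group `S_{mn}` on the replicas. -/
abbrev ReplicaPerm (n m : ℕ) := Equiv.Perm (Fin n × Fin m)

/-- `g_B : (k, ℓ) ↦ (k, ℓ + 1)`, cyclically in `ℓ`. -/
def gB (n m : ℕ) : ReplicaPerm n m := Equiv.prodCongrRight fun _ => finRotate m

/-- `γ : (k, ℓ) ↦ (k + 1, ℓ)`, cyclically in `k`, on the lower half; the upper half is fixed. -/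
def lowerShift (n m : ℕ) : ReplicaPerm n m :=
  Equiv.prodCongrLeft fun ℓ : Fin m => if (ℓ : ℕ) < m / 2 then 1 else finRotate n

/-- `g_A = γ⁻¹ g_B γ`. -/
def gA (n m : ℕ) : ReplicaPerm n m := (lowerShift n m)⁻¹ * gB n m * lowerShift n m

/-- The permutation of `Fin m` which rotates the upper half `{0, …, m / 2 - 1}` cyclically and rotates
the lower half `{m / 2, …, m - 1}` cyclically. -/
def halfRotate (m : ℕ) : Equiv.Perm (Fin m) :=
  (finSumFinEquiv.trans (finCongr (show m / 2 + (m - m / 2) = m by omega))).permCongr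
    (Equiv.sumCongr (finRotate (m / 2)) (finRotate (m - m / 2)))

/-- `X`, which rotates every half circle of replicas cyclically. -/
def gX (n m : ℕ) : ReplicaPerm n m := Equiv.prodCongrRight fun _ => halfRotate m

/-! ### Cuts in a weighted graph -/

section Graph

variable {V : Type*}

/-- The edges of `G` that have some vertex in `S`. -/
def edgesAt (G : SimpleGraph V) (S : Set V) : Set (Sym2 V) := {e ∈ G.edgeSet | ∃ v ∈ S, v ∈ e}

/-- `μ(S : T) = E[S] ∩ E[T]`. -/
def cutSurface (G : SimpleGraph V) (S T : Set V) : Set (Sym2 V) := edgesAt G S ∩ edgesAt G T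

open Classical in
/-- The sum of `f` over the edges of `G`. -/
noncomputable def edgeSum [Fintype V] (G : SimpleGraph V) (f : Sym2 V → ℝ) : ℝ := ∑ e ∈ G.edgeFinset, f e

open Classical in
/-- The total weight of a set `F` of edges. -/
noncomputable def weight [Fintype V] (G : SimpleGraph V) (w : Sym2 V → ℝ) (F : Set (Sym2 V)) : ℝ :=
  ∑ e ∈ G.edgeFinset with e ∈ F, w e

/-- `r` is a cut for `A : B`. -/
def IsCut (A B r : Set V) : Prop := A ⊆ r ∧ B ⊆ rᶜ

/-- The area `w(μ(r))` of a cut. -/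
noncomputable def cutArea [Fintype V] (G : SimpleGraph V) (w : Sym2 V → ℝ) (r : Set V) : ℝ :=
  weight G w (cutSurface G r rᶜ)

/-- The areas of all the cuts for `A : B`. -/
def cutValues [Fintype V] (G : SimpleGraph V) (w : Sym2 V → ℝ) (A B : Set V) : Set ℝ :=
  {c | ∃ r, IsCut A B r ∧ cutArea G w r = c}

/-- The area `𝒜(A : B)` of a minimal cut. -/
noncomputable def minCut [Fintype V] (G : SimpleGraph V) (w : Sym2 V → ℝ) (A B : Set V) : ℝ :=
  sInf (cutValues G w A B)

/-- `r` is a minimal cut for `A : B`. -/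
def IsMinCut [Fintype V] (G : SimpleGraph V) (w : Sym2 V → ℝ) (A B r : Set V) : Prop :=
  IsCut A B r ∧ ∀ s, IsCut A B s → cutArea G w r ≤ cutArea G w s

/-- `(α, β, γ)` is a triway cut for `A : B : C`. -/
def IsTriwayCut (A B C α β γ : Set V) : Prop :=
  α ∪ β ∪ γ = Set.univ ∧ Disjoint α β ∧ Disjoint β γ ∧ Disjoint γ α ∧ A ⊆ α ∧ B ⊆ β ∧ C ⊆ γ

/-- The area of `(α, β, γ)` for the tensions `tAB`, `tBC`, `tCA`. -/
noncomputable def triwayArea [Fintype V] (G : SimpleGraph V) (w : Sym2 V → ℝ) (tAB tBC tCA : ℝ)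
    (α β γ : Set V) : ℝ :=
  tAB * weight G w (cutSurface G α β) + tBC * weight G w (cutSurface G β γ)
    + tCA * weight G w (cutSurface G γ α)

/-- The areas of all the triway cuts for `A : B : C`. -/
def triwayValues [Fintype V] (G : SimpleGraph V) (w : Sym2 V → ℝ) (tAB tBC tCA : ℝ) (A B C : Set V) : Set ℝ :=
  {c | ∃ α β γ, IsTriwayCut A B C α β γ ∧ triwayArea G w tAB tBC tCA α β γ = c}

/-- The area `𝒜_t(A : B : C)` of a minimal triway cut. -/
noncomputable def minTriwayCut [Fintype V] (G : SimpleGraph V) (w : Sym2 V → ℝ) (tAB tBC tCA : ℝ)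
    (A B C : Set V) : ℝ :=
  sInf (triwayValues G w tAB tBC tCA A B C)

/-- `(α, β, γ)` is a minimal triway cut for `A : B : C`. -/
def IsMinTriwayCut [Fintype V] (G : SimpleGraph V) (w : Sym2 V → ℝ) (tAB tBC tCA : ℝ)
    (A B C α β γ : Set V) : Prop :=
  IsTriwayCut A B C α β γ ∧ ∀ α' β' γ', IsTriwayCut A B C α' β' γ' →
    triwayArea G w tAB tBC tCA α β γ ≤ triwayArea G w tAB tBC tCA α' β' γ'

/-! ### The reflected entropy optimization `R` -/

/-- The boundary conditions on `g : V → S_{mn}`. -/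
def RFeasible (n m : ℕ) (A B C : Set V) (g : V → ReplicaPerm n m) : Prop :=
  (∀ x ∈ A, g x = gA n m) ∧ (∀ x ∈ B, g x = gB n m) ∧ ∀ x ∈ C, g x = 1

/-- `R(g) = ∑_{e = {x, y}} w(e) d(g(x), g(y))`. -/
noncomputable def RObjective [Fintype V] {n m : ℕ} (G : SimpleGraph V) (w : Sym2 V → ℝ)
    (g : V → ReplicaPerm n m) : ℝ :=
  edgeSum G fun e => w e *
    (Sym2.lift ⟨fun x y => cayleyDist (g x) (g y), fun x y => cayleyDist_comm (g x) (g y)⟩ e : ℤ)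

def RValues [Fintype V] (n m : ℕ) (G : SimpleGraph V) (w : Sym2 V → ℝ) (A B C : Set V) : Set ℝ :=
  {c | ∃ g : V → ReplicaPerm n m, RFeasible n m A B C g ∧ RObjective G w g = c}

noncomputable def R [Fintype V] (n m : ℕ) (G : SimpleGraph V) (w : Sym2 V → ℝ) (A B C : Set V) : ℝ :=
  sInf (RValues n m G w A B C)

/-! ### The set partition optimization `Q` -/

/-- The partitions of the set of the `2n` blocks of `P(X)`. -/
abbrev BlockPartition (n m : ℕ) := Setoid (Quotient (cyclePartition (gX n m)))

/-- The boundary conditions `q(A) = q_X(g_A)`, `q(B) = q_X(g_B)`, `q(C) = id`. -/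
def QFeasible (n m : ℕ) (A B C : Set V) (q : V → BlockPartition n m) : Prop :=
  (∀ x ∈ A, q x = coarsen (gX n m) (gA n m)) ∧ (∀ x ∈ B, q x = coarsen (gX n m) (gB n m)) ∧
    ∀ x ∈ C, q x = ⊥

/-- `Q(q) = ∑_{e = {x, y}} w(e) d(q(x), q(y))`. -/
noncomputable def QObjective [Fintype V] {n m : ℕ} (G : SimpleGraph V) (w : Sym2 V → ℝ)
    (q : V → BlockPartition n m) : ℝ :=
  edgeSum G fun e => w e *
    (Sym2.lift ⟨fun x y => partitionDist (q x) (q y),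
      fun x y => partitionDist_comm (q x) (q y)⟩ e : ℤ)

def QValues [Fintype V] (n m : ℕ) (G : SimpleGraph V) (w : Sym2 V → ℝ) (A B C : Set V) : Set ℝ :=
  {c | ∃ q : V → BlockPartition n m, QFeasible n m A B C q ∧ QObjective G w q = c}

noncomputable def Q [Fintype V] (n m : ℕ) (G : SimpleGraph V) (w : Sym2 V → ℝ) (A B C : Set V) : ℝ :=
  sInf (QValues n m G w A B C)

/-! ### The Boolean optimization `B` -/

/-- The sum of `r` along a walk, every edge being counted as often as it is traversed. -/
def walkSum {G : SimpleGraph V} {x y : V} (L : G.Walk x y) (r : Sym2 V → ℕ) : ℕ :=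
  (L.edges.map r).sum

/-- The boundary conditions on `b : V → B_{2n}`; `⊤` is the string `11…1` and `⊥` is `00…0`. -/
def BoolFeasible (n : ℕ) (A B C : Set V) (b : V → Fin (2 * n) → Bool) : Prop :=
  (∀ x ∈ A, b x = ⊤) ∧ (∀ x ∈ B, b x = ⊤) ∧ ∀ x ∈ C, b x = ⊥

open Classical in
/-- The constraints on `r` in the program `B(b)`. The bitwise `and` of `b` along the walk `L` is
`⨅ v ∈ L.support, b v`. -/
def BoolConstraints (n : ℕ) (G : SimpleGraph V) (A B : Set V) (b : V → Fin (2 * n) → Bool)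
    (r : Sym2 V → ℕ) : Prop :=
  (∀ x ∈ A, ∀ y ∈ B, ∀ L : G.Walk x y, ∃ j : ℕ,
      (walkSum L r : ℤ) = 2 * ((n : ℤ) - if (⨅ v ∈ L.support, b v) = ⊤ then 1 else 0) + 2 * j) ∧
    ∀ x y, G.Adj x y → ⌈(hammingDist (b x) (b y) : ℚ) / 2⌉₊ ≤ r s(x, y)

def BoolValuesAt [Fintype V] (n : ℕ) (G : SimpleGraph V) (w : Sym2 V → ℝ) (A B : Set V)
    (b : V → Fin (2 * n) → Bool) : Set ℝ :=
  {c | ∃ r : Sym2 V → ℕ, BoolConstraints n G A B b r ∧ edgeSum G (fun e => w e * r e) = c}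

/-- `B(b)`. -/
noncomputable def BoolOptAt [Fintype V] (n : ℕ) (G : SimpleGraph V) (w : Sym2 V → ℝ) (A B : Set V)
    (b : V → Fin (2 * n) → Bool) : ℝ :=
  sInf (BoolValuesAt n G w A B b)

def BoolValues [Fintype V] (n : ℕ) (G : SimpleGraph V) (w : Sym2 V → ℝ) (A B C : Set V) : Set ℝ :=
  {c | ∃ b, BoolFeasible n A B C b ∧ BoolOptAt n G w A B b = c}

/-- The optimal value `B = min_b B(b)`. -/
noncomputable def BoolOpt [Fintype V] (n : ℕ) (G : SimpleGraph V) (w : Sym2 V → ℝ) (A B C : Set V) : ℝ :=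
  sInf (BoolValues n G w A B C)

/-! ### The integer program `I` -/

/-- The constraints on `ρ` and `σ`. -/
def IntConstraints (n : ℕ) (G : SimpleGraph V) (A B C : Set V) (ρ σ : Sym2 V → ℕ) : Prop :=
  (∀ x ∈ A, ∀ y ∈ B, ∀ L : G.Walk x y, ∃ j : ℕ,
      (walkSum L (fun e => σ e + ρ e) : ℤ) =
        2 * ((n : ℤ) - if walkSum L ρ = 0 then 1 else 0) + 2 * j) ∧
    ∀ x ∈ A ∪ B, ∀ y ∈ C, ∀ L : G.Walk x y, n ≤ walkSum L ρ

def IntValues [Fintype V] (n : ℕ) (G : SimpleGraph V) (w : Sym2 V → ℝ) (A B C : Set V) : Set ℝ :=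
  {c | ∃ ρ σ : Sym2 V → ℕ, IntConstraints n G A B C ρ σ ∧
    edgeSum G (fun e => w e * ((σ e : ℝ) + ρ e)) = c}

noncomputable def IntOpt [Fintype V] (n : ℕ) (G : SimpleGraph V) (w : Sym2 V → ℝ) (A B C : Set V) : ℝ :=
  sInf (IntValues n G w A B C)

open Classical in
/-- The configuration `g_A` on `α`, `g_B` on `β`, `id` on `rC` and `X` elsewhere. -/
noncomputable def cutConfig (n m : ℕ) (α β rC : Set V) (x : V) : ReplicaPerm n m :=
  if x ∈ α then gA n m else if x ∈ β then gB n m else if x ∈ rC then 1 else gX n m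

end Graph

end TriwayCut

/-! The five values are squeezed in a cycle: `R` minus `n(m-2)` minimal cuts ≥ `Q` ≥ `BoolOpt` ≥
`IntOpt` ≥ `minTriwayCut` ≥ `R` minus `n(m-2)` minimal cuts.

`R` to `Q`: the cycle partition contracts the Cayley distance (`partitionDist_le_cayleyDist`). The
partition distance splits into the distance of the partitions coarsened by `X` and a remainder that
dominates the change of `rankDefect`. This defect is `n(m-2)` on `A ∪ B` and `0` on `C`, so by its
level sets it pays for `n(m-2)` minimal cuts (`mul_minCut_le`).

`Q` to `BoolOpt`: record for every half circle whether it shares its block, and let `r` be the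
partition distance. Two bits change per unit of distance at most (`card_isPaired_ne_le`). The
partition distance has the parity of the sum of the block numbers, so walk sums from `A` to `B` are
even. They are at least `2(n-1)`, and at least `2n` once the walk meets a partition with a
singleton, because the half circles form one cycle under the circles of `g_A` and `g_B`
(`blocks_sup_add_blocks_sup_le`).

`BoolOpt` to `IntOpt`: `ρ` is half the Hamming distance rounded up and `σ` is the rest of `r`.

`IntOpt` to `minTriwayCut`: distances in the metrics `ρ` and `σ + ρ` give potentials, and two random
thresholds turn them into a triway cut whose expected area is at most the objective
(`exists_triwayCut_le_of_potentials`).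

`minTriwayCut` to `R`: uncrossing makes `γ` contain a minimal cut `rC`
(`exists_isMinTriwayCut_superset`), and `cutConfig` costs at most the triway area plus `n(m-2)`
times the area of `rC`. -/

namespace TriwayCut

/-! ### Counting blocks -/

section Partitions

variable {α β : Type*}

/-- The functions that are constant on the blocks of a partition. -/
def blockFunctions (p : Setoid α) : Submodule ℚ (α → ℚ) where
  carrier := {f | p ≤ Setoid.ker f}
  zero_mem' := fun _ _ _ => rfl
  add_mem' := fun {f g} hf hg x y h => by
    have h1 : f x = f y := hf h
    have h2 : g x = g y := hg h
    simp [Setoid.ker_def, h1, h2]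
  smul_mem' := fun c f hf x y h => by
    have h1 : f x = f y := hf h
    simp [Setoid.ker_def, h1]

theorem mem_blockFunctions {p : Setoid α} {f : α → ℚ} :
    f ∈ blockFunctions p ↔ p ≤ Setoid.ker f := Iff.rfl

/-- Joins become intersections of subspaces and block numbers become dimensions, so lattice
inequalities follow from linear algebra. -/
theorem blockFunctions_sup (p q : Setoid α) :
    blockFunctions (p ⊔ q) = blockFunctions p ⊓ blockFunctions q := by
  ext f
  simp [mem_blockFunctions]

theorem blockFunctions_anti {p q : Setoid α} (h : p ≤ q) : blockFunctions q ≤ blockFunctions p :=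
  fun _ hf => h.trans hf

/-- Functions constant on the blocks are functions on the set of blocks. -/
def blockFunctionsEquiv (p : Setoid α) : blockFunctions p ≃ₗ[ℚ] (Quotient p → ℚ) where
  toFun f := Quotient.lift f.1 fun _ _ h => f.2 h
  invFun f := ⟨f ∘ Quotient.mk p, fun x y h => by simp [Setoid.ker_def, Quotient.sound h]⟩
  map_add' f g := by
    ext x
    induction x using Quotient.ind
    rfl
  map_smul' c f := by
    ext x
    induction x using Quotient.ind
    rfl
  left_inv f := rfl
  right_inv f := by
    ext x
    induction x using Quotient.ind
    rfl

theorem finrank_blockFunctions [Finite α] (p : Setoid α) :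
    Module.finrank ℚ (blockFunctions p) = blocks p := by
  have := Fintype.ofFinite (Quotient p)
  rw [(blockFunctionsEquiv p).finrank_eq, Module.finrank_fintype_fun_eq_card, blocks,
    Nat.card_eq_fintype_card]

/-- The rank function of the partition lattice is submodular. -/
theorem blocks_submodular [Finite α] (a b c : Setoid α) :
    blocks (a ⊔ c) + blocks (b ⊔ c) ≤ blocks c + blocks (a ⊔ b ⊔ c) := by
  have := Fintype.ofFinite α
  -- Dimension formula: the two subspaces meet in that of `a ⊔ b ⊔ c`, and their sum lies in that of
  -- `c`.
  have h := Submodule.finrank_sup_add_finrank_inf_eq (blockFunctions (a ⊔ c))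
    (blockFunctions (b ⊔ c))
  rw [← blockFunctions_sup, finrank_blockFunctions, finrank_blockFunctions,
    finrank_blockFunctions] at h
  have h2 : blockFunctions (a ⊔ c) ⊔ blockFunctions (b ⊔ c) ≤ blockFunctions c :=
    sup_le (blockFunctions_anti le_sup_right) (blockFunctions_anti le_sup_right)
  have h3 := Submodule.finrank_mono h2
  rw [finrank_blockFunctions] at h3
  have h4 : a ⊔ c ⊔ (b ⊔ c) = a ⊔ b ⊔ c := by
    rw [sup_sup_sup_comm, sup_idem]
  rw [h4] at h
  omega

theorem blocks_anti [Finite α] {p q : Setoid α} (h : p ≤ q) : blocks q ≤ blocks p := by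
  have := Fintype.ofFinite α
  rw [← finrank_blockFunctions, ← finrank_blockFunctions]
  exact Submodule.finrank_mono (blockFunctions_anti h)

theorem blocks_strictAnti [Finite α] {p q : Setoid α} (h : p ≤ q) {x y : α} (hq : q x y)
    (hp : ¬ p x y) : blocks q < blocks p := by
  classical
  have := Fintype.ofFinite α
  rw [← finrank_blockFunctions, ← finrank_blockFunctions]
  refine Submodule.finrank_lt_finrank_of_lt (lt_of_le_of_ne (blockFunctions_anti h) fun he => hp ?_)
  -- The indicator of the `p`-block of `x` separates the two subspaces, since `q` relates `x` to a
  -- point outside that block.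
  have hf : (fun z => if p x z then (1 : ℚ) else 0) ∈ blockFunctions p := by
    intro u v huv
    have : p x u ↔ p x v := ⟨fun h => p.trans' h huv, fun h => p.trans' h (p.symm' huv)⟩
    simp [Setoid.ker_def, this]
  rw [← he] at hf
  have h1 := hf hq
  by_contra hxy
  simp [Setoid.ker_def, hxy] at h1

theorem blocks_ker (f : α → β) : blocks (Setoid.ker f) = Nat.card (Set.range f) :=
  Nat.card_congr (Setoid.quotientKerEquivRange f)

theorem blocks_ker_of_surjective {f : α → β} (hf : Function.Surjective f) :
    blocks (Setoid.ker f) = Nat.card β :=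
  Nat.card_congr (Setoid.quotientKerEquivOfSurjective f hf)

theorem blocks_bot : blocks (⊥ : Setoid α) = Nat.card α :=
  Nat.card_congr Setoid.quotientBotEquiv

theorem blocks_comap {f : α → β} (hf : Function.Surjective f) (s : Setoid β) :
    blocks (Setoid.comap f s) = blocks s := by
  rw [Setoid.comap_eq]
  exact blocks_ker_of_surjective (Quotient.mk_surjective.comp hf)

theorem comap_sup {f : α → β} (hf : Function.Surjective f) (s t : Setoid β) :
    Setoid.comap f (s ⊔ t) = Setoid.comap f s ⊔ Setoid.comap f t := by
  apply le_antisymm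
  · set u := Setoid.comap f s ⊔ Setoid.comap f t with hu
    have hk : Setoid.ker f ≤ u := fun x y h => by
      refine (le_sup_left : Setoid.comap f s ≤ u) ?_
      have h' : f x = f y := h
      rw [Setoid.comap_rel, h']
    rw [← Setoid.comap_map_of_ker_le f u hk]
    have key : s ⊔ t ≤ u.map f := by
      apply sup_le
      · intro x y h
        obtain ⟨x, rfl⟩ := hf x
        obtain ⟨y, rfl⟩ := hf y
        exact Setoid.le_comap_map ((le_sup_left : Setoid.comap f s ≤ u) h)
      · intro x y h
        obtain ⟨x, rfl⟩ := hf x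
        obtain ⟨y, rfl⟩ := hf y
        exact Setoid.le_comap_map ((le_sup_right : Setoid.comap f t ≤ u) h)
    exact fun x y h => key h
  · exact sup_le (fun x y h => (le_sup_left : s ≤ s ⊔ t) h) (fun x y h => (le_sup_right : t ≤ s ⊔ t) h)

/-- Submodularity over the middle partition `q`, followed by dropping `q` from the triple join. -/
theorem partitionDist_triangle [Finite α] (p q r : Setoid α) :
    partitionDist p r ≤ partitionDist p q + partitionDist q r := by
  have h1 := blocks_submodular p r q
  have h2 : blocks (p ⊔ r ⊔ q) ≤ blocks (p ⊔ r) := blocks_anti le_sup_left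
  rw [sup_comm r q] at h1
  unfold partitionDist
  omega

theorem partitionDist_nonneg [Finite α] (p q : Setoid α) : 0 ≤ partitionDist p q := by
  have h1 : blocks (p ⊔ q) ≤ blocks p := blocks_anti le_sup_left
  have h2 : blocks (p ⊔ q) ≤ blocks q := blocks_anti le_sup_right
  unfold partitionDist
  omega

open Classical in
/-- The partition whose only possibly nontrivial block is `{a, b}`. -/
noncomputable def pairSetoid (a b : α) : Setoid α := Setoid.ker fun x => if x = b then a else x

theorem pairSetoid_rel (a b : α) : pairSetoid a b a b := by
  classical
  change (if a = b then a else a) = if b = b then a else b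
  simp

theorem pairSetoid_le {a b : α} {s : Setoid α} (h : s a b) : pairSetoid a b ≤ s := by
  classical
  intro x y hxy
  change (if x = b then a else x) = if y = b then a else y at hxy
  split_ifs at hxy with hx hy hy
  · subst hx hy; exact s.refl' _
  · subst hx hxy; exact s.symm' h
  · subst hy hxy; exact h
  · subst hxy; exact s.refl' _

theorem blocks_le_sup_pairSetoid [Finite α] (p : Setoid α) (a b : α) :
    blocks p ≤ blocks (p ⊔ pairSetoid a b) + 1 := by
  classical
  have h1 := blocks_submodular p (pairSetoid a b) ⊥
  rw [sup_bot_eq, sup_bot_eq, sup_bot_eq, blocks_bot] at h1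
  have h2 : Nat.card α ≤ blocks (pairSetoid a b) + 1 := by
    rw [pairSetoid, blocks_ker]
    have hsub : ({b}ᶜ : Set α) ⊆ Set.range fun x => if x = b then a else x := by
      intro x hx
      exact ⟨x, by simp at hx; simp [hx]⟩
    have := Set.ncard_le_ncard hsub
    have h3 := Set.ncard_add_ncard_compl ({b} : Set α)
    rw [Set.ncard_singleton] at h3
    rw [Nat.card_coe_set_eq]
    omega
  omega

end Partitions

/-! ### Cycles of permutations -/

section Permutations

variable {α β : Type*}

theorem cyclePartition_rel (g : Equiv.Perm α) (x : α) : cyclePartition g x (g x) :=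
  Equiv.Perm.sameCycle_apply_right.2 (Equiv.Perm.SameCycle.refl g x)

theorem cyclePartition_le {g : Equiv.Perm α} {s : Setoid α} (h : ∀ x, s x (g x)) :
    cyclePartition g ≤ s := by
  have hnat : ∀ (k : ℕ) (x : α), s x ((g ^ k) x) := by
    intro k
    induction k with
    | zero => exact fun x => s.refl' x
    | succ k ih =>
      intro x
      rw [pow_succ', Equiv.Perm.mul_apply]
      exact s.trans' (ih x) (h _)
  rintro x y ⟨i, rfl⟩
  obtain ⟨k, rfl | rfl⟩ := i.eq_nat_or_neg
  · exact hnat k x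
  · have h1 := hnat k ((g ^ (-(k : ℤ))) x)
    rw [← Equiv.Perm.mul_apply, zpow_neg, zpow_natCast, mul_inv_cancel, Equiv.Perm.one_apply] at h1
    exact s.symm' (by simpa using h1)

theorem cyclePartition_one : cyclePartition (1 : Equiv.Perm α) = ⊥ :=
  le_bot_iff.1 (cyclePartition_le fun _ => rfl)

theorem cyclePartition_mul_le (g h : Equiv.Perm α) :
    cyclePartition (g * h) ≤ cyclePartition g ⊔ cyclePartition h :=
  cyclePartition_le fun x => (cyclePartition g ⊔ cyclePartition h).trans'
    ((le_sup_right : cyclePartition h ≤ _) (cyclePartition_rel h x))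
    ((le_sup_left : cyclePartition g ≤ _) (cyclePartition_rel g (h x)))

/-- If `f` is constant on the cycles of `g`, then `g` has at least as many cycles as `f` has values. -/
theorem card_range_le_blocks [Finite α] {g : Equiv.Perm α} {f : α → β} (h : ∀ x, f (g x) = f x) :
    Nat.card (Set.range f) ≤ blocks (cyclePartition g) := by
  rw [← blocks_ker]
  exact blocks_anti (cyclePartition_le fun x => (h x).symm)

theorem blocks_le_card [Finite α] (p : Setoid α) : blocks p ≤ Nat.card α := by
  rw [← blocks_bot]
  exact blocks_anti bot_le

/-- The cycles of a product refine the join of the cycle partitions of the factors, and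
submodularity over `⊥` says that the rank of a join is at most the sum of the ranks. -/
theorem cayleyDist_triangle [Finite α] (g h k : Equiv.Perm α) :
    cayleyDist g k ≤ cayleyDist g h + cayleyDist h k := by
  have h1 := blocks_submodular (cyclePartition (g * h⁻¹)) (cyclePartition (h * k⁻¹)) ⊥
  simp only [sup_bot_eq, blocks_bot] at h1
  have h2 := blocks_anti (cyclePartition_mul_le (g * h⁻¹) (h * k⁻¹))
  rw [show g * h⁻¹ * (h * k⁻¹) = g * k⁻¹ by group] at h2
  unfold cayleyDist
  omega

theorem cayleyDist_self (g : Equiv.Perm α) : cayleyDist g g = 0 := by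
  simp [cayleyDist, cyclePartition_one, blocks_bot]

/-- Multiplication by a transposition of points in different cycles joins these cycles. -/
theorem sameCycle_swap_mul [Finite α] [DecidableEq α] (g : Equiv.Perm α) (a b : α) :
    cyclePartition g a b ∨ cyclePartition (Equiv.swap a b * g) a b := by
  by_cases hg : cyclePartition g a b
  · exact Or.inl hg
  right
  have hab : ∀ i : ℕ, (g ^ i) a ≠ b := fun i hi => hg ⟨i, by simpa using hi⟩
  obtain ⟨k, hk0, hk⟩ : ∃ k : ℕ, 0 < k ∧ (g ^ k) a = a :=
    ⟨orderOf g, orderOf_pos g, by simp [pow_orderOf_eq_one]⟩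
  classical
  have hex : ∃ k : ℕ, 0 < k ∧ (g ^ k) a = a := ⟨k, hk0, hk⟩
  obtain ⟨hk0, hk⟩ := Nat.find_spec hex
  have hmin : ∀ i, 0 < i → i < Nat.find hex → (g ^ i) a ≠ a :=
    fun i hi hlt h => Nat.find_min hex hlt ⟨hi, h⟩
  generalize Nat.find hex = k at hk0 hk hmin
  -- `k` is the first return time of `a` under `g`. Before it the orbit avoids both `a` and `b`, so
  -- the transposition has no effect; at time `k` it replaces `a` by `b`.
  have hpow : ∀ i, i < k → ((Equiv.swap a b * g) ^ i) a = (g ^ i) a := by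
    intro i
    induction i with
    | zero => simp
    | succ i ih =>
      intro hi
      have h1 : (g ^ (i + 1)) a = g ((g ^ i) a) := by rw [pow_succ', Equiv.Perm.mul_apply]
      rw [pow_succ', Equiv.Perm.mul_apply, ih (by omega), Equiv.Perm.mul_apply, ← h1,
        Equiv.swap_apply_of_ne_of_ne (hmin _ (by omega) hi) (hab _)]
  refine ⟨(k : ℤ), ?_⟩
  rw [zpow_natCast]
  obtain ⟨i, rfl⟩ : ∃ i, k = i + 1 := ⟨k - 1, by omega⟩
  have h1 : (g ^ (i + 1)) a = g ((g ^ i) a) := by rw [pow_succ', Equiv.Perm.mul_apply]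
  rw [pow_succ', Equiv.Perm.mul_apply, hpow i (by omega), Equiv.Perm.mul_apply, ← h1, hk,
    Equiv.swap_apply_left]

/-- Once `a` and `b` are identified the transposition is invisible. One inclusion suffices, because
multiplying by it twice gives back `g`. -/
theorem cyclePartition_swap_mul_sup [DecidableEq α] (g : Equiv.Perm α) (a b : α) :
    cyclePartition (Equiv.swap a b * g) ⊔ pairSetoid a b = cyclePartition g ⊔ pairSetoid a b := by
  have key : ∀ g : Equiv.Perm α,
      cyclePartition (Equiv.swap a b * g) ≤ cyclePartition g ⊔ pairSetoid a b := by
    intro g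
    have hs : cyclePartition (Equiv.swap a b) ≤ pairSetoid a b := by
      apply cyclePartition_le
      intro x
      rcases eq_or_ne x a with rfl | ha
      · simpa using pairSetoid_rel x b
      rcases eq_or_ne x b with rfl | hb
      · simpa using (pairSetoid a x).symm' (pairSetoid_rel a x)
      · rw [Equiv.swap_apply_of_ne_of_ne ha hb]
    refine (cyclePartition_mul_le _ _).trans ?_
    rw [sup_comm]
    exact sup_le_sup_left hs _
  apply le_antisymm
  · exact sup_le (key g) le_sup_right
  · have h := key (Equiv.swap a b * g)
    rw [← mul_assoc, Equiv.swap_mul_self, one_mul] at h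
    exact sup_le h le_sup_right

/-- One of the two partitions already joins `a` and `b`. It is therefore the common join with the
pair, and the other one refines it with at most one more block. -/
theorem partitionDist_swap_mul_le [Finite α] [DecidableEq α] (g : Equiv.Perm α) (a b : α) :
    partitionDist (cyclePartition g) (cyclePartition (Equiv.swap a b * g)) ≤ 1 := by
  have hJ := cyclePartition_swap_mul_sup g a b
  have h1 := blocks_le_sup_pairSetoid (cyclePartition g) a b
  have h2 := blocks_le_sup_pairSetoid (cyclePartition (Equiv.swap a b * g)) a b
  have h3 : blocks (cyclePartition g ⊔ pairSetoid a b) ≤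
      blocks (cyclePartition g ⊔ cyclePartition (Equiv.swap a b * g)) := by
    apply blocks_anti
    refine sup_le le_sup_left ?_
    rw [← hJ]
    exact le_sup_left
  unfold partitionDist
  rcases sameCycle_swap_mul g a b with h | h
  · rw [hJ] at h2
    rw [sup_eq_left.2 (pairSetoid_le h)] at h1 h2 h3
    omega
  · rw [← hJ] at h1 h3
    rw [sup_eq_left.2 (pairSetoid_le h)] at h1 h2 h3
    omega

/-- The genus inequality: the cycle partition is a contraction from the Cayley distance to the
distance of partitions. -/
theorem partitionDist_le_cayleyDist [Finite α] (g h : Equiv.Perm α) :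
    partitionDist (cyclePartition g) (cyclePartition h) ≤ cayleyDist g h := by
  classical
  obtain ⟨N, hN⟩ : ∃ N : ℕ, Nat.card α - blocks (cyclePartition (g * h⁻¹)) = N := ⟨_, rfl⟩
  induction N using Nat.strong_induction_on generalizing g with
  | _ N ih =>
    have hle := blocks_le_card (cyclePartition (g * h⁻¹))
    by_cases hgh : g * h⁻¹ = 1
    · obtain rfl : g = h := mul_inv_eq_one.1 hgh
      rw [cayleyDist_self]
      simp [partitionDist]
      omega
    · set π := g * h⁻¹ with hπ
      -- The transposition of `a` and `π a` splits the fixed point `a` off its cycle in `π`. This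
      -- lowers the Cayley distance to `h` and moves the cycle partition of `g` by at most one, so
      -- the triangle inequality closes the induction.
      obtain ⟨a, ha⟩ : ∃ a, π a ≠ a := by
        by_contra! hcon
        exact hgh (Equiv.ext hcon)
      have hrel : cyclePartition π a (π a) := cyclePartition_rel π a
      have hJ := cyclePartition_swap_mul_sup π a (π a)
      rw [sup_eq_left.2 (pairSetoid_le hrel)] at hJ
      have hfix : (Equiv.swap a (π a) * π) a = a := by simp
      have hlt : blocks (cyclePartition π) < blocks (cyclePartition (Equiv.swap a (π a) * π)) := by
        refine blocks_strictAnti (hJ ▸ le_sup_left) hrel fun hcon => ha ?_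
        obtain ⟨i, hi⟩ := hcon
        rw [Equiv.Perm.zpow_apply_eq_self_of_apply_eq_self hfix] at hi
        exact hi.symm
      have hle' := blocks_le_card (cyclePartition (Equiv.swap a (π a) * π))
      have hmul : Equiv.swap a (π a) * π = Equiv.swap a (π a) * g * h⁻¹ := by
        rw [hπ, mul_assoc]
      have h1 := ih (Nat.card α - blocks (cyclePartition (Equiv.swap a (π a) * π))) (by omega)
        (Equiv.swap a (π a) * g) (by rw [hmul])
      have h2 := partitionDist_triangle (cyclePartition g)
        (cyclePartition (Equiv.swap a (π a) * g)) (cyclePartition h)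
      have h3 := partitionDist_swap_mul_le g a (π a)
      unfold cayleyDist at h1 ⊢
      rw [← hmul] at h1
      rw [← hπ]
      omega

theorem cyclePartition_conj (g γ : Equiv.Perm α) :
    cyclePartition (γ⁻¹ * g * γ) = Setoid.comap γ (cyclePartition g) := by
  ext x y
  have h := Equiv.Perm.sameCycle_conj (f := g) (g := γ⁻¹) (x := x) (y := y)
  rw [inv_inv] at h
  exact h

theorem cayleyDist_conj (g h γ : Equiv.Perm α) :
    cayleyDist (γ⁻¹ * g * γ) (γ⁻¹ * h * γ) = cayleyDist g h := by
  have h1 : γ⁻¹ * g * γ * (γ⁻¹ * h * γ)⁻¹ = γ⁻¹ * (g * h⁻¹) * γ := by group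
  unfold cayleyDist
  rw [h1, cyclePartition_conj, blocks_comap γ.surjective]

/-- A bound on the Cayley distance from a function that does not distinguish `g` and `h`. -/
theorem cayleyDist_le_of_range [Finite α] {g h : Equiv.Perm α} {f : α → β}
    (hf : ∀ x, f (g x) = f (h x)) : cayleyDist g h ≤ Nat.card α - Nat.card (Set.range f) := by
  have := card_range_le_blocks (g := g * h⁻¹) (f := f) fun x => by
    rw [Equiv.Perm.mul_apply, hf, ← Equiv.Perm.mul_apply, mul_inv_cancel, Equiv.Perm.one_apply]
  unfold cayleyDist
  omega

end Permutations

/-! ### The partition into blocks of a reference permutation -/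

section Coarsen

variable {α : Type*} (g₀ : Equiv.Perm α)

theorem comap_coarsen (g : Equiv.Perm α) :
    Setoid.comap (Quotient.mk (cyclePartition g₀)) (coarsen g₀ g) =
      cyclePartition g ⊔ cyclePartition g₀ := by
  rw [coarsen, ← Setoid.mapOfSurjective_eq_map]
  exact Setoid.comap_map_of_ker_le _ _ fun x y h =>
    (le_sup_right : cyclePartition g₀ ≤ _) (Quotient.exact h)

theorem blocks_coarsen (g : Equiv.Perm α) :
    blocks (coarsen g₀ g) = blocks (cyclePartition g ⊔ cyclePartition g₀) := by
  rw [← comap_coarsen, blocks_comap Quotient.mk_surjective]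

theorem blocks_coarsen_sup (g h : Equiv.Perm α) :
    blocks (coarsen g₀ g ⊔ coarsen g₀ h) =
      blocks (cyclePartition g ⊔ cyclePartition h ⊔ cyclePartition g₀) := by
  rw [← blocks_comap (Quotient.mk_surjective (s := cyclePartition g₀)),
    comap_sup Quotient.mk_surjective]
  erw [comap_coarsen, comap_coarsen]
  rw [sup_sup_sup_comm, sup_idem]

theorem coarsen_one : coarsen g₀ 1 = ⊥ := by
  apply Setoid.comap_injective _ (Quotient.mk_surjective (s := cyclePartition g₀))
  erw [comap_coarsen]
  rw [cyclePartition_one, bot_sup_eq]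
  ext x y
  exact Quotient.eq.symm

/-- The loss of rank when the partition `P(g)` is joined with `P(g₀)`. -/
noncomputable def rankDefect (p : Setoid α) : ℤ :=
  (blocks (p ⊔ cyclePartition g₀) : ℤ) - blocks p + Nat.card α - blocks (cyclePartition g₀)

/-- Submodularity over `p`: joining with `P(g₀)` merges fewer blocks the coarser the partition
already is. -/
theorem rankDefect_mono [Finite α] {p q : Setoid α} (h : p ≤ q) :
    rankDefect g₀ p ≤ rankDefect g₀ q := by
  have h1 := blocks_submodular q (cyclePartition g₀) p
  rw [sup_eq_left.2 h, sup_comm _ p, sup_eq_left.2 (h.trans le_sup_left : p ≤ q ⊔ cyclePartition g₀)] at h1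
  unfold rankDefect
  omega

theorem rankDefect_bot : rankDefect g₀ ⊥ = 0 := by
  simp [rankDefect, blocks_bot]

theorem rankDefect_of_le {p : Setoid α} (h : cyclePartition g₀ ≤ p) :
    rankDefect g₀ p = Nat.card α - blocks (cyclePartition g₀) := by
  simp [rankDefect, sup_eq_left.2 h]

/-- The Cayley distance bounds the distance of the coarsened partitions and the change of the rank
defect simultaneously. -/
theorem partitionDist_coarsen_add_le [Finite α] (g h : Equiv.Perm α) :
    partitionDist (coarsen g₀ g) (coarsen g₀ h) +
      |rankDefect g₀ (cyclePartition g) - rankDefect g₀ (cyclePartition h)| ≤ cayleyDist g h := by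
  refine le_trans ?_ (partitionDist_le_cayleyDist g h)
  have h1 := rankDefect_mono g₀ (le_sup_left : cyclePartition g ≤ cyclePartition g ⊔ cyclePartition h)
  have h2 := rankDefect_mono g₀ (le_sup_right : cyclePartition h ≤ cyclePartition g ⊔ cyclePartition h)
  -- An exact splitting of the distance. By monotonicity the defect of the join is at least either
  -- defect, so the second summand is at least their difference in absolute value.
  have h3 : partitionDist (cyclePartition g) (cyclePartition h) =
      partitionDist (coarsen g₀ g) (coarsen g₀ h) +
        (2 * rankDefect g₀ (cyclePartition g ⊔ cyclePartition h) -
          rankDefect g₀ (cyclePartition g) - rankDefect g₀ (cyclePartition h)) := by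
    unfold partitionDist rankDefect
    rw [blocks_coarsen, blocks_coarsen, blocks_coarsen_sup]
    ring
  rw [h3]
  have : |rankDefect g₀ (cyclePartition g) - rankDefect g₀ (cyclePartition h)| ≤
      2 * rankDefect g₀ (cyclePartition g ⊔ cyclePartition h) -
          rankDefect g₀ (cyclePartition g) - rankDefect g₀ (cyclePartition h) :=
    abs_le.2 ⟨by linarith, by linarith⟩
  linarith

end Coarsen

/-! ### The boundary permutations -/

section Boundary

theorem finRotate_val {n : ℕ} (i : Fin n) :
    (finRotate n i : ℕ) = if (i : ℕ) + 1 = n then 0 else (i : ℕ) + 1 := by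
  cases n with
  | zero => exact i.elim0
  | succ n =>
    rw [coe_finRotate]
    simp [Fin.ext_iff]

theorem halfRotate_val {m : ℕ} (i : Fin m) :
    (halfRotate m i : ℕ) = if (i : ℕ) + 1 = m / 2 then 0
      else if (i : ℕ) + 1 = m then m / 2 else (i : ℕ) + 1 := by
  set e := finSumFinEquiv.trans (finCongr (show m / 2 + (m - m / 2) = m by omega)) with he
  obtain ⟨x, rfl⟩ := e.surjective i
  have h : halfRotate m (e x) =
      e (Equiv.sumCongr (finRotate (m / 2)) (finRotate (m - m / 2)) x) := by
    rw [halfRotate, ← he, Equiv.permCongr_apply, Equiv.symm_apply_apply]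
  rw [h]
  rcases x with j | j
  · have h1 := j.2
    have h2 := finRotate_val j
    rw [Equiv.sumCongr_apply, Sum.map_inl]
    generalize finRotate (m / 2) j = i at *
    simp [he]
    split_ifs at * <;> omega
  · have h1 := j.2
    have h2 := finRotate_val j
    rw [Equiv.sumCongr_apply, Sum.map_inr]
    generalize finRotate (m - m / 2) j = i at *
    simp [he]
    split_ifs at * <;> omega

variable {n m : ℕ}

theorem gB_apply (k : Fin n) (i : Fin m) : gB n m (k, i) = (k, finRotate m i) := rfl

theorem gX_apply (k : Fin n) (i : Fin m) : gX n m (k, i) = (k, halfRotate m i) := rfl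

theorem lowerShift_apply (k : Fin n) (i : Fin m) :
    lowerShift n m (k, i) = (if (i : ℕ) < m / 2 then k else finRotate n k, i) := by
  change ((if (i : ℕ) < m / 2 then (1 : Equiv.Perm (Fin n)) else finRotate n) k, i) = _
  split_ifs <;> rfl

theorem lowerShift_fst_snd (x : Fin n × Fin m) : (lowerShift n m x).2 = x.2 := rfl

/-- The half circle of a replica; `true` is the upper half. -/
def halfCircle (n m : ℕ) (x : Fin n × Fin m) : Fin n × Bool := (x.1, decide ((x.2 : ℕ) < m / 2))

theorem halfCircle_surjective (hm : 2 ≤ m) : Function.Surjective (halfCircle n m) := by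
  rintro ⟨k, b⟩
  cases b
  · exact ⟨(k, ⟨m / 2, by omega⟩), by simp [halfCircle]⟩
  · exact ⟨(k, ⟨0, by omega⟩), by simp [halfCircle]; omega⟩

theorem cyclePartition_gB (n m : ℕ) :
    cyclePartition (gB n m) = Setoid.ker (Prod.fst : Fin n × Fin m → Fin n) := by
  apply le_antisymm
  · exact cyclePartition_le fun x => rfl
  · have h0 : ∀ (k : Fin n) (j : ℕ) (hj : j < m),
        cyclePartition (gB n m) (k, ⟨0, by omega⟩) (k, ⟨j, hj⟩) := by
      intro k j
      induction j with
      | zero => exact fun _ => Setoid.refl' _ _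
      | succ j ih =>
        intro hj
        refine Setoid.trans' _ (ih (by omega)) ?_
        convert cyclePartition_rel (gB n m) (k, ⟨j, by omega⟩) using 1
        rw [gB_apply]
        ext
        · rfl
        · rw [finRotate_val]
          simp
          omega
    rintro ⟨k, i⟩ ⟨k', j⟩ h
    obtain rfl : k = k' := h
    exact Setoid.trans' _ (Setoid.symm' _ (h0 k i i.2)) (h0 k j j.2)

theorem cyclePartition_gX (hm : Even m) :
    cyclePartition (gX n m) = Setoid.ker (halfCircle n m) := by
  obtain ⟨p, hp⟩ := hm
  apply le_antisymm
  · refine cyclePartition_le fun ⟨k, i⟩ => ?_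
    change halfCircle n m (k, i) = halfCircle n m (gX n m (k, i))
    rw [gX_apply, halfCircle, halfCircle, halfRotate_val]
    have := i.2
    simp only [Prod.mk.injEq, true_and, decide_eq_decide]
    split_ifs <;> omega
  · have h0 : ∀ (k : Fin n) (j : ℕ) (hj : j < m / 2),
        cyclePartition (gX n m) (k, ⟨0, by omega⟩) (k, ⟨j, by omega⟩) := by
      intro k j
      induction j with
      | zero => exact fun _ => Setoid.refl' _ _
      | succ j ih =>
        intro hj
        refine Setoid.trans' _ (ih (by omega)) ?_
        convert cyclePartition_rel (gX n m) (k, ⟨j, by omega⟩) using 1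
        rw [gX_apply]
        ext
        · rfl
        · rw [halfRotate_val]
          simp
          split_ifs <;> omega
    have h1 : ∀ (k : Fin n) (j : ℕ) (hj : m / 2 + j < m),
        cyclePartition (gX n m) (k, ⟨m / 2, by omega⟩) (k, ⟨m / 2 + j, hj⟩) := by
      intro k j
      induction j with
      | zero => exact fun _ => Setoid.refl' _ _
      | succ j ih =>
        intro hj
        refine Setoid.trans' _ (ih (by omega)) ?_
        convert cyclePartition_rel (gX n m) (k, ⟨m / 2 + j, by omega⟩) using 1
        rw [gX_apply]
        ext
        · rfl
        · rw [halfRotate_val]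
          simp
          split_ifs <;> omega
    rintro ⟨k, i⟩ ⟨k', j⟩ h
    simp only [Setoid.ker_def, halfCircle, Prod.mk.injEq, decide_eq_decide] at h
    obtain ⟨rfl, hij⟩ := h
    by_cases hi : (i : ℕ) < m / 2
    · exact Setoid.trans' _ (Setoid.symm' _ (h0 k i hi)) (h0 k j (hij.1 hi))
    · have hi' : i = ⟨m / 2 + (i - m / 2), by omega⟩ := by ext; simp; omega
      have hj' : j = ⟨m / 2 + (j - m / 2), by omega⟩ := by ext; simp; omega
      rw [hi', hj']
      exact Setoid.trans' _ (Setoid.symm' _ (h1 k _ (by omega))) (h1 k _ (by omega))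

/-- The circle of `g_A` that contains a half circle. -/
def circleA (n : ℕ) (x : Fin n × Bool) : Fin n := if x.2 then x.1 else finRotate n x.1

theorem cyclePartition_gA (n m : ℕ) :
    cyclePartition (gA n m) = Setoid.ker (circleA n ∘ halfCircle n m) := by
  rw [gA, cyclePartition_conj, cyclePartition_gB]
  ext ⟨k, i⟩ ⟨k', i'⟩
  simp [Setoid.ker_def, lowerShift_apply, circleA, halfCircle]

theorem cyclePartition_gX_le_gA (hm : Even m) :
    cyclePartition (gX n m) ≤ cyclePartition (gA n m) := by
  rw [cyclePartition_gX hm, cyclePartition_gA]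
  exact fun x y h => congrArg (circleA n) h

theorem cyclePartition_gX_le_gB (hm : Even m) :
    cyclePartition (gX n m) ≤ cyclePartition (gB n m) := by
  rw [cyclePartition_gX hm, cyclePartition_gB]
  intro x y h
  have h' : halfCircle n m x = halfCircle n m y := h
  exact (Prod.mk.inj h').1

theorem circleA_surjective (n : ℕ) : Function.Surjective (circleA n) := fun k => ⟨(k, true), rfl⟩

theorem blocks_gX (hm : 2 ≤ m) (hm' : Even m) : blocks (cyclePartition (gX n m)) = 2 * n := by
  rw [cyclePartition_gX hm', blocks_ker_of_surjective (halfCircle_surjective hm)]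
  simp [mul_comm]

theorem blocks_gA (hm : 2 ≤ m) : blocks (cyclePartition (gA n m)) = n := by
  rw [cyclePartition_gA, blocks_ker_of_surjective
    ((circleA_surjective n).comp (halfCircle_surjective hm))]
  simp

theorem blocks_gB (hm : 2 ≤ m) : blocks (cyclePartition (gB n m)) = n := by
  rw [cyclePartition_gB, blocks_ker_of_surjective fun k => ⟨(k, ⟨0, by omega⟩), rfl⟩]
  simp

theorem cayleyDist_gX_one (hm : 2 ≤ m) (hm' : Even m) :
    cayleyDist (gX n m) 1 = n * (m - 2) := by
  rw [cayleyDist, inv_one, mul_one, blocks_gX hm hm']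
  simp
  ring

theorem cayleyDist_gB_gX_le (hm : 2 ≤ m) (hm' : Even m) : cayleyDist (gB n m) (gX n m) ≤ n := by
  obtain ⟨p, hp⟩ := hm'
  -- On each circle `g_B` and `X` differ only by exchanging the images `0` and `m / 2`, which `f`
  -- identifies. It keeps `n(m-1)` values, so the distance is at most `n`.
  let f : Fin n × Fin m → Fin n × ℕ := fun x => (x.1, if (x.2 : ℕ) = m / 2 then 0 else x.2)
  have hf : ∀ x, f (gB n m x) = f (gX n m x) := by
    rintro ⟨k, i⟩
    have := i.2
    simp only [f, gB_apply, gX_apply, finRotate_val, halfRotate_val, Prod.mk.injEq, true_and]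
    split_ifs <;> omega
  refine (cayleyDist_le_of_range hf).trans ?_
  have hinj : Function.Injective fun x : Fin n × Fin (m - 1) =>
      (⟨f (x.1, if h : (x.2 : ℕ) < m / 2 then ⟨x.2, by omega⟩ else ⟨x.2 + 1, by omega⟩),
        Set.mem_range_self _⟩ : Set.range f) := by
    rintro ⟨k, i⟩ ⟨k', i'⟩ h
    simp only [f, Subtype.mk.injEq, Prod.mk.injEq] at h
    obtain ⟨rfl, h⟩ := h
    ext
    · rfl
    · simp only
      split_ifs at h <;> simp_all <;> omega
  have hcard := Nat.card_le_card_of_injective _ hinj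
  simp only [Nat.card_eq_fintype_card, Fintype.card_prod, Fintype.card_fin] at hcard ⊢
  rw [← Nat.card_eq_fintype_card] at hcard
  zify [show 1 ≤ m by omega] at hcard
  rw [← Nat.card_eq_fintype_card]
  push_cast
  linarith

/-- `γ` moves half circles as a whole and `X` preserves each of them. Conjugation by `γ` thus
carries the bound for `g_B` over to `g_A`. -/
theorem lowerShift_commute_gX (hm : Even m) :
    (lowerShift n m)⁻¹ * gX n m * lowerShift n m = gX n m := by
  obtain ⟨p, hp⟩ := hm
  rw [mul_assoc, inv_mul_eq_iff_eq_mul]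
  ext ⟨k, i⟩
  · have := i.2
    simp only [Equiv.Perm.mul_apply, lowerShift_apply, gX_apply, halfRotate_val]
    split_ifs <;> first | rfl | omega
  · simp only [Equiv.Perm.mul_apply, lowerShift_apply, gX_apply]

theorem cayleyDist_gA_gX_le (hm : 2 ≤ m) (hm' : Even m) : cayleyDist (gA n m) (gX n m) ≤ n := by
  have h := cayleyDist_conj (gB n m) (gX n m) (lowerShift n m)
  rw [lowerShift_commute_gX hm'] at h
  rw [gA, h]
  exact cayleyDist_gB_gX_le hm hm'

theorem cayleyDist_gA_gB_le (hn : 2 ≤ n) (hm : 2 ≤ m) (hm' : Even m) :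
    cayleyDist (gA n m) (gB n m) ≤ 2 * (n - 1) := by
  obtain ⟨p, hp⟩ := hm'
  -- The shift in `γ` cancels unless a step passes between the halves, that is, unless it lands on
  -- position `0` or `m / 2`. There `f` forgets the circle, which leaves `n(m-2) + 2` values.
  let f : Fin n × Fin m → ℕ × ℕ := fun x =>
    if (x.2 : ℕ) = 0 then (0, 0) else if (x.2 : ℕ) = m / 2 then (0, m / 2) else (x.1, x.2)
  have hf : ∀ x, f (gA n m x) = f (gB n m x) := by
    rintro ⟨k, i⟩
    have hi := i.2
    have hA : lowerShift n m (gA n m (k, i)) = gB n m (lowerShift n m (k, i)) := by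
      rw [gA, mul_assoc, ← Equiv.Perm.mul_apply, mul_inv_cancel_left, Equiv.Perm.mul_apply]
    have hsnd : (gA n m (k, i)).2 = finRotate m i := by
      rw [← lowerShift_fst_snd, hA, lowerShift_apply, gB_apply]
    obtain ⟨k', i', hki⟩ : ∃ k' i', gA n m (k, i) = (k', i') := ⟨_, _, rfl⟩
    rw [hki] at hsnd hA ⊢
    simp only at hsnd
    subst hsnd
    rw [gB_apply]
    have hr := finRotate_val i
    by_cases h0 : (finRotate m i : ℕ) = 0
    · simp only [f, if_pos h0]
    by_cases h1 : (finRotate m i : ℕ) = m / 2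
    · simp only [f, if_neg h0, if_pos h1]
    rw [lowerShift_apply, lowerShift_apply, gB_apply] at hA
    simp only [Prod.mk.injEq, and_true] at hA
    have : k' = k := by
      by_cases hlt : (i : ℕ) < m / 2
      · rw [if_pos hlt, if_pos (by split_ifs at hr <;> omega)] at hA
        exact hA
      · rw [if_neg hlt, if_neg (by split_ifs at hr <;> omega)] at hA
        exact (finRotate n).injective hA
    rw [this]
  refine (cayleyDist_le_of_range hf).trans ?_
  let g : (Fin n × Fin (m - 2)) ⊕ Bool → Fin n × Fin m := fun x => x.elim
    (fun y => (y.1, if h : (y.2 : ℕ) + 1 < m / 2 then ⟨y.2 + 1, by omega⟩ else ⟨y.2 + 2, by omega⟩))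
    (fun b => (⟨0, by omega⟩, if b then ⟨0, by omega⟩ else ⟨m / 2, by omega⟩))
  have hinj : Function.Injective fun x => (⟨f (g x), Set.mem_range_self _⟩ : Set.range f) := by
    have hg1 : ∀ (k : Fin n) (i : Fin (m - 2)), f (g (Sum.inl (k, i))) =
        ((k : ℕ), if (i : ℕ) + 1 < m / 2 then (i : ℕ) + 1 else i + 2) := by
      intro k i
      simp only [f, g, Sum.elim_inl]
      split_ifs <;> simp_all <;> omega
    have hg2 : ∀ b, f (g (Sum.inr b)) = (0, if b then 0 else m / 2) := by
      intro b
      cases b <;> simp [f, g]; omega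
    rintro (⟨k, i⟩ | b) (⟨k', i'⟩ | b') h <;> simp only [Subtype.mk.injEq] at h
    · rw [hg1, hg1, Prod.mk.injEq] at h
      obtain ⟨h1, h2⟩ := h
      congr 2
      · exact Fin.ext h1
      · apply Fin.ext
        split_ifs at h2 <;> omega
    · rw [hg1, hg2, Prod.mk.injEq] at h
      have := h.2; split_ifs at this <;> omega
    · rw [hg1, hg2, Prod.mk.injEq] at h
      have := h.2; split_ifs at this <;> omega
    · rw [hg2, hg2, Prod.mk.injEq] at h
      cases b <;> cases b' <;> simp_all <;> omega
  have hcard := Nat.card_le_card_of_injective _ hinj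
  have hb : Nat.card Bool = 2 := by simp
  rw [Nat.card_sum, Nat.card_prod, Nat.card_fin, Nat.card_fin, hb] at hcard
  rw [Nat.card_prod, Nat.card_fin, Nat.card_fin]
  zify [hm] at hcard
  push_cast
  linarith

theorem cayleyDist_gA_one_le (hm : 2 ≤ m) (hm' : Even m) :
    cayleyDist (gA n m) 1 ≤ n + n * (m - 2) := by
  have h := cayleyDist_triangle (gA n m) (gX n m) 1
  rw [cayleyDist_gX_one hm hm'] at h
  linarith [cayleyDist_gA_gX_le (n := n) hm hm']

theorem cayleyDist_gB_one_le (hm : 2 ≤ m) (hm' : Even m) :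
    cayleyDist (gB n m) 1 ≤ n + n * (m - 2) := by
  have h := cayleyDist_triangle (gB n m) (gX n m) 1
  rw [cayleyDist_gX_one hm hm'] at h
  linarith [cayleyDist_gB_gX_le (n := n) hm hm']

theorem rankDefect_gA (hm : 2 ≤ m) (hm' : Even m) :
    rankDefect (gX n m) (cyclePartition (gA n m)) = n * (m - 2) := by
  rw [rankDefect_of_le _ (cyclePartition_gX_le_gA hm'), blocks_gX hm hm']
  simp
  ring

theorem rankDefect_gB (hm : 2 ≤ m) (hm' : Even m) :
    rankDefect (gX n m) (cyclePartition (gB n m)) = n * (m - 2) := by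
  rw [rankDefect_of_le _ (cyclePartition_gX_le_gB hm'), blocks_gX hm hm']
  simp
  ring

end Boundary

/-! ### Singleton blocks -/

section Singletons

variable {α β : Type*}

/-- The block of `i` has another element. -/
def IsPaired (p : Setoid α) (i : α) : Prop := ∃ j, j ≠ i ∧ p i j

theorem IsPaired.mono {p q : Setoid α} (h : p ≤ q) {i : α} (hi : IsPaired p i) : IsPaired q i := by
  obtain ⟨j, hj, hij⟩ := hi
  exact ⟨j, hj, h hij⟩

/-- A surjection for which the points of `S` do not have a fibre of their own shrinks the cardinality
by at least half of that of `S`. -/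
theorem card_add_two_mul_card_le [Fintype α] [Fintype β] {f : α → β}
    (hf : Function.Surjective f) (S : Finset α) (hS : ∀ s ∈ S, ∃ t, t ≠ s ∧ f t = f s) :
    S.card + 2 * Fintype.card β ≤ 2 * Fintype.card α := by
  classical
  have h1 : S.card = ∑ b : β, (S.filter fun a => f a = b).card :=
    Finset.card_eq_sum_card_fiberwise fun _ _ => Finset.mem_coe.2 (Finset.mem_univ _)
  have h2 : Fintype.card α = ∑ b : β, (Finset.univ.filter fun a => f a = b).card :=
    Finset.card_eq_sum_card_fiberwise fun _ _ => Finset.mem_coe.2 (Finset.mem_univ _)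
  have h3 : 2 * Fintype.card β = ∑ _b : β, 2 := by simp [mul_comm]
  rw [h1, h2, h3, Finset.mul_sum, ← Finset.sum_add_distrib]
  -- Fibre by fibre: every fibre is nonempty, and a fibre that meets `S` has at least two points.
  refine Finset.sum_le_sum fun b _ => ?_
  have hsub : (S.filter fun a => f a = b).card ≤ (Finset.univ.filter fun a => f a = b).card :=
    Finset.card_le_card (Finset.filter_subset_filter _ (Finset.subset_univ _))
  rcases (S.filter fun a => f a = b).eq_empty_or_nonempty with h | ⟨s, hs⟩
  · obtain ⟨a, ha⟩ := hf b
    have : 0 < (Finset.univ.filter fun a => f a = b).card :=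
      Finset.card_pos.2 ⟨a, by simpa using ha⟩
    rw [h, Finset.card_empty]
    omega
  · rw [Finset.mem_filter] at hs
    obtain ⟨t, hts, ht⟩ := hS s hs.1
    have : 1 < (Finset.univ.filter fun a => f a = b).card :=
      Finset.one_lt_card.2 ⟨s, by simpa using hs.2, t, by simpa [ht] using hs.2, hts.symm⟩
    omega

open Classical in
-- A newly paired element is a whole block of `p` that `q` merges with another block. A single merge
-- can use up two such blocks, hence the factor `2`.
theorem card_newlyPaired_le [Fintype α] {p q : Setoid α} (h : p ≤ q) :
    ((Finset.univ.filter fun i => IsPaired q i ∧ ¬ IsPaired p i).card : ℤ) ≤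
      2 * ((blocks p : ℤ) - blocks q) := by
  have hinj : Set.InjOn (Quotient.mk p)
      (Finset.univ.filter fun i => IsPaired q i ∧ ¬ IsPaired p i : Finset α) := by
    intro i hi j _ hij
    simp only [Finset.coe_filter, Finset.mem_univ, true_and, Set.mem_ofPred_eq] at hi
    by_contra hne
    exact hi.2 ⟨j, Ne.symm hne, Quotient.exact hij⟩
  have hsurj : Function.Surjective (Setoid.map_of_le h) := by
    intro b
    induction b using Quotient.ind with
    | _ x => exact ⟨Quotient.mk p x, rfl⟩
  have key := card_add_two_mul_card_le hsurj
    ((Finset.univ.filter fun i => IsPaired q i ∧ ¬ IsPaired p i).image (Quotient.mk p)) (by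
      intro s hs
      rw [Finset.mem_image] at hs
      obtain ⟨i, hi, rfl⟩ := hs
      simp only [Finset.mem_filter, Finset.mem_univ, true_and] at hi
      obtain ⟨⟨j, hj, hij⟩, hp⟩ := hi
      exact ⟨Quotient.mk p j, fun he => hp ⟨j, hj, p.symm' (Quotient.exact he)⟩,
        Quotient.sound (q.symm' hij)⟩)
  rw [Finset.card_image_of_injOn hinj, ← Nat.card_eq_fintype_card, ← Nat.card_eq_fintype_card] at key
  unfold blocks
  omega

open Classical in
-- Every change of status is a new pairing on the way up from `p` or from `q` to the join, and the
-- distance counts the merges on both ways.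
theorem card_isPaired_ne_le [Fintype α] (p q : Setoid α) :
    ((Finset.univ.filter fun i => ¬ (IsPaired p i ↔ IsPaired q i)).card : ℤ) ≤
      2 * partitionDist p q := by
  have h1 := card_newlyPaired_le (le_sup_left : p ≤ p ⊔ q)
  have h2 := card_newlyPaired_le (le_sup_right : q ≤ p ⊔ q)
  have h3 : (Finset.univ.filter fun i => ¬ (IsPaired p i ↔ IsPaired q i)) ⊆
      (Finset.univ.filter fun i => IsPaired (p ⊔ q) i ∧ ¬ IsPaired p i) ∪
        (Finset.univ.filter fun i => IsPaired (p ⊔ q) i ∧ ¬ IsPaired q i) := by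
    intro i hi
    simp only [Finset.mem_filter, Finset.mem_univ, true_and, Finset.mem_union] at hi ⊢
    by_cases hp : IsPaired p i
    · exact Or.inr ⟨hp.mono le_sup_left, fun hq => hi ⟨fun _ => hq, fun _ => hp⟩⟩
    · have hq : IsPaired q i := by
        by_contra hq
        exact hi ⟨fun h => absurd h hp, fun h => absurd h hq⟩
      exact Or.inl ⟨hq.mono le_sup_right, hp⟩
  have h4 := (Finset.card_le_card h3).trans (Finset.card_union_le _ _)
  unfold partitionDist
  omega

/-- The partition in which the element `i` has been removed from its block. -/
def isolate (p : Setoid α) (i : α) : Setoid α where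
  r x y := x = y ∨ p x y ∧ x ≠ i ∧ y ≠ i
  iseqv :=
    { refl := fun _ => Or.inl rfl
      symm := by
        rintro x y (rfl | ⟨h, hx, hy⟩)
        · exact Or.inl rfl
        · exact Or.inr ⟨p.symm' h, hy, hx⟩
      trans := by
        rintro x y z (rfl | ⟨h, hx, hy⟩) (rfl | ⟨h', hy', hz⟩)
        · exact Or.inl rfl
        · exact Or.inr ⟨h', hy', hz⟩
        · exact Or.inr ⟨h, hx, hy⟩
        · exact Or.inr ⟨p.trans' h h', hx, hz⟩ }

theorem isolate_le (p : Setoid α) (i : α) : isolate p i ≤ p := by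
  rintro x y (rfl | ⟨h, _⟩)
  · exact p.refl' _
  · exact h

/-- Neither `p` nor `isolate a i` connects `i` to anything, so `{i}` remains a block of their join,
while `a` itself absorbs it. -/
theorem blocks_sup_lt_of_singleton [Finite α] {p a : Setoid α} {i : α} (hp : ¬ IsPaired p i)
    (ha : IsPaired a i) : blocks (p ⊔ a) < blocks (p ⊔ isolate a i) := by
  obtain ⟨j, hj, hij⟩ := ha
  refine blocks_strictAnti (x := i) (y := j) (sup_le_sup_left (isolate_le a i) p)
    ((le_sup_right : a ≤ _) hij) fun h => ?_
  have hle : p ⊔ isolate a i ≤ Setoid.ker (· = i) := by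
    apply sup_le
    · intro x y hxy
      rw [Setoid.ker_def, eq_iff_iff]
      constructor
      · rintro rfl
        by_contra hy
        exact hp ⟨y, hy, hxy⟩
      · rintro rfl
        by_contra hx
        exact hp ⟨x, hx, p.symm' hxy⟩
    · rintro x y (rfl | ⟨_, hx, hy⟩)
      · exact Setoid.refl' _ _
      · simp [Setoid.ker_def, hx, hy]
  have h' : (i = i) = (j = i) := hle h
  simp [hj] at h'

/-- Two pairings that form a cycle together satisfy a sharpened form of submodularity over every
partition with a singleton. -/
theorem blocks_sup_add_blocks_sup_le [Finite α] {a b p : Setoid α} {N : ℕ} (hN : 0 < N) {c : ℕ → α}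
    (hsurj : Function.Surjective c) (hinj : ∀ s t, c s = c t → s ≡ t [MOD N])
    (hper : ∀ t, c (t + N) = c t) (hstep : ∀ t, a (c t) (c (t + 1)) ∨ b (c t) (c (t + 1)))
    (ha : ∀ i, IsPaired a i) (hb : ∀ i, IsPaired b i) {i : α} (hp : ¬ IsPaired p i) :
    blocks (p ⊔ a) + blocks (p ⊔ b) ≤ blocks p := by
  -- Plain submodularity for `a` and `b` falls short by one. Isolating `i` gains one block in each
  -- of the two joins, while the isolated partitions together still leave at most two blocks: `{i}`
  -- and the rest of the cycle.
  have h1 := blocks_sup_lt_of_singleton hp (ha i)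
  have h2 := blocks_sup_lt_of_singleton hp (hb i)
  have h3 := blocks_submodular (isolate a i) (isolate b i) p
  rw [sup_comm (isolate a i) p, sup_comm (isolate b i) p] at h3
  obtain ⟨t₀, rfl⟩ := hsurj i
  have hNE : ∀ s, 0 < s → s < N → c (t₀ + s) ≠ c t₀ := by
    intro s hs0 hsN h
    have h' : t₀ + s ≡ t₀ + 0 [MOD N] := hinj _ _ h
    have h'' := Nat.ModEq.add_left_cancel' t₀ h'
    rw [Nat.ModEq, Nat.mod_eq_of_lt hsN, Nat.zero_mod] at h''
    omega
  set u := isolate a (c t₀) ⊔ isolate b (c t₀) with hu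
  -- A cycle without one of its points is a connected path.
  have hrel : ∀ s, s + 1 < N → u (c (t₀ + 1)) (c (t₀ + (s + 1))) := by
    intro s
    induction s with
    | zero => exact fun _ => u.refl' _
    | succ s ih =>
      intro hs
      refine u.trans' (ih (by omega)) ?_
      have e1 := hNE (s + 1) (by omega) (by omega)
      have e2 := hNE (s + 1 + 1) (by omega) hs
      rcases hstep (t₀ + (s + 1)) with h | h
      · exact (le_sup_left : isolate a (c t₀) ≤ u) (Or.inr ⟨h, e1, e2⟩)
      · exact (le_sup_right : isolate b (c t₀) ≤ u) (Or.inr ⟨h, e1, e2⟩)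
  have hmul : ∀ k t, c (t + N * k) = c t := by
    intro k
    induction k with
    | zero => simp
    | succ k ih => intro t; rw [Nat.mul_succ, ← add_assoc, hper, ih]
  have hall : ∀ x, x ≠ c t₀ → u (c (t₀ + 1)) x := by
    intro x hx
    obtain ⟨t, rfl⟩ := hsurj x
    obtain ⟨s, hs, hts⟩ : ∃ s < N, c t = c (t₀ + s) := by
      -- Adding `N * t₀`, a multiple of the period, keeps the subtraction of `t₀` from truncating.
      refine ⟨(t + N * t₀ - t₀) % N, Nat.mod_lt _ hN, ?_⟩
      have hle : t₀ ≤ N * t₀ := Nat.le_mul_of_pos_left t₀ hN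
      rw [← hmul t₀ t, ← hmul ((t + N * t₀ - t₀) / N) (t₀ + _), add_assoc, Nat.mod_add_div]
      congr 1
      omega
    rw [hts] at hx ⊢
    obtain ⟨s, rfl⟩ : ∃ s', s = s' + 1 := by
      cases s with
      | zero => exact absurd rfl hx
      | succ s => exact ⟨s, rfl⟩
    exact hrel s hs
  have hker : Setoid.ker (· = c t₀) ≤ u := by
    intro x y hxy
    rw [Setoid.ker_def, eq_iff_iff] at hxy
    by_cases hx : x = c t₀
    · rw [hx, hxy.1 hx]
    · exact u.trans' (u.symm' (hall x hx)) (hall y fun hy => hx (hxy.2 hy))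
  have h4 : blocks (u ⊔ p) ≤ 2 := by
    refine (blocks_anti (hker.trans le_sup_left)).trans ?_
    rw [blocks_ker]
    refine (Nat.card_mono Set.finite_univ (Set.subset_univ _)).trans ?_
    simp
  omega

end Singletons

/-! ### The boundary partitions -/

section BoundaryPartitions

variable {n m : ℕ}

theorem coarsen_gA_rel (hm : Even m) (x y : Fin n × Fin m) :
    coarsen (gX n m) (gA n m) (Quotient.mk _ x) (Quotient.mk _ y) ↔
      circleA n (halfCircle n m x) = circleA n (halfCircle n m y) := by
  rw [← Setoid.comap_rel (Quotient.mk (cyclePartition (gX n m)))]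
  erw [comap_coarsen]
  rw [sup_eq_left.2 (cyclePartition_gX_le_gA hm), cyclePartition_gA]
  rfl

theorem coarsen_gB_rel (hm : Even m) (x y : Fin n × Fin m) :
    coarsen (gX n m) (gB n m) (Quotient.mk _ x) (Quotient.mk _ y) ↔
      (halfCircle n m x).1 = (halfCircle n m y).1 := by
  rw [← Setoid.comap_rel (Quotient.mk (cyclePartition (gX n m)))]
  erw [comap_coarsen]
  rw [sup_eq_left.2 (cyclePartition_gX_le_gB hm), cyclePartition_gB]
  rfl

theorem mk_gX_eq_iff (hm : Even m) (x y : Fin n × Fin m) :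
    Quotient.mk (cyclePartition (gX n m)) x = Quotient.mk _ y ↔
      halfCircle n m x = halfCircle n m y := by
  rw [Quotient.eq, cyclePartition_gX hm]
  rfl

theorem blocks_coarsen_gA (hm : 2 ≤ m) (hm' : Even m) :
    blocks (coarsen (gX n m) (gA n m)) = n := by
  rw [blocks_coarsen, sup_eq_left.2 (cyclePartition_gX_le_gA hm'), blocks_gA hm]

theorem blocks_coarsen_gB (hm : 2 ≤ m) (hm' : Even m) :
    blocks (coarsen (gX n m) (gB n m)) = n := by
  rw [blocks_coarsen, sup_eq_left.2 (cyclePartition_gX_le_gB hm'), blocks_gB hm]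

theorem card_halfCircles (hm : 2 ≤ m) (hm' : Even m) :
    Nat.card (Quotient (cyclePartition (gX n m))) = 2 * n := blocks_gX hm hm'

/-- The half circles in the order in which the circles of `g_A` and `g_B` connect them. -/
def halfCircleSeq (hn : 0 < n) (hm : 2 ≤ m) (t : ℕ) : Quotient (cyclePartition (gX n m)) :=
  Quotient.mk _ (⟨t / 2 % n, Nat.mod_lt _ hn⟩, if Even t then ⟨0, by omega⟩ else ⟨m / 2, by omega⟩)

theorem halfCircle_seq (hn : 0 < n) (hm : 2 ≤ m) (t : ℕ) :
    halfCircle n m (⟨t / 2 % n, Nat.mod_lt _ hn⟩,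
      if Even t then ⟨0, by omega⟩ else ⟨m / 2, by omega⟩) =
      (⟨t / 2 % n, Nat.mod_lt _ hn⟩, decide (Even t)) := by
  by_cases h : Even t
  · simp [halfCircle, h]
    omega
  · simp [halfCircle, h]

theorem halfCircleSeq_surjective (hn : 0 < n) (hm : 2 ≤ m) (hm' : Even m) :
    Function.Surjective (halfCircleSeq hn hm) := by
  intro x
  induction x using Quotient.ind with
  | _ x =>
    obtain ⟨k, b, hkb⟩ : ∃ k b, halfCircle n m x = (k, b) := ⟨_, _, rfl⟩
    cases b
    · refine ⟨2 * k + 1, (mk_gX_eq_iff hm' _ _).2 ?_⟩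
      rw [halfCircle_seq hn hm, hkb]
      have h1 : (2 * (k : ℕ) + 1) / 2 = k := by omega
      simp [h1, Nat.mod_eq_of_lt k.2, parity_simps]
    · refine ⟨2 * k, (mk_gX_eq_iff hm' _ _).2 ?_⟩
      rw [halfCircle_seq hn hm, hkb]
      simp [Nat.mod_eq_of_lt k.2]

theorem halfCircleSeq_eq (hn : 0 < n) (hm : 2 ≤ m) (hm' : Even m) {s t : ℕ}
    (h : halfCircleSeq hn hm s = halfCircleSeq hn hm t) : s ≡ t [MOD 2 * n] := by
  have h' := (mk_gX_eq_iff hm' _ _).1 h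
  rw [halfCircle_seq hn hm, halfCircle_seq hn hm, Prod.mk.injEq, Fin.mk.injEq, decide_eq_decide,
    Nat.even_iff, Nat.even_iff] at h'
  have h2 : s % 2 = t % 2 := by omega
  have h1 : s / 2 ≡ t / 2 [MOD n] := h'.1
  have h3 := (h1.mul_left' 2).add_right (s % 2)
  rwa [Nat.div_add_mod, h2, Nat.div_add_mod] at h3

theorem halfCircleSeq_add (hn : 0 < n) (hm : 2 ≤ m) (hm' : Even m) (t : ℕ) :
    halfCircleSeq hn hm (t + 2 * n) = halfCircleSeq hn hm t := by
  refine (mk_gX_eq_iff hm' _ _).2 ?_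
  rw [halfCircle_seq hn hm, halfCircle_seq hn hm]
  have h1 : (t + 2 * n) / 2 = t / 2 + n := by omega
  simp [h1, parity_simps]

theorem halfCircleSeq_rel_even (hn : 0 < n) (hm : 2 ≤ m) (hm' : Even m) {t : ℕ} (ht : Even t) :
    coarsen (gX n m) (gB n m) (halfCircleSeq hn hm t) (halfCircleSeq hn hm (t + 1)) := by
  refine (coarsen_gB_rel hm' _ _).2 ?_
  rw [halfCircle_seq hn hm, halfCircle_seq hn hm]
  obtain ⟨s, rfl⟩ := ht
  have h1 : (s + s + 1) / 2 = (s + s) / 2 := by omega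
  simp [h1]

/-- A circle of `g_A` consists of the lower half of circle `k` and the upper half of circle `k + 1`,
so these steps link consecutive circles of `g_B`. -/
theorem halfCircleSeq_rel_odd (hn : 0 < n) (hm : 2 ≤ m) (hm' : Even m) {t : ℕ} (ht : ¬ Even t) :
    coarsen (gX n m) (gA n m) (halfCircleSeq hn hm t) (halfCircleSeq hn hm (t + 1)) := by
  refine (coarsen_gA_rel hm' _ _).2 ?_
  rw [halfCircle_seq hn hm, halfCircle_seq hn hm]
  have h1 : (t + 1) / 2 = t / 2 + 1 := by
    rw [Nat.even_iff] at ht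
    omega
  have h2 : Even (t + 1) := by simpa [parity_simps] using ht
  simp only [circleA, ht, h2, decide_false, decide_true, if_true, Bool.false_eq_true, if_false]
  apply Fin.ext
  rw [finRotate_val, h1]
  simp only
  rw [← Nat.mod_add_mod]
  split_ifs with h
  · rw [h, Nat.mod_self]
  · exact (Nat.mod_eq_of_lt (by have := Nat.mod_lt (t / 2) hn; omega)).symm

theorem halfCircleSeq_succ_ne (hn : 0 < n) (hm : 2 ≤ m) (hm' : Even m) (t : ℕ) :
    halfCircleSeq hn hm (t + 1) ≠ halfCircleSeq hn hm t := by
  intro h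
  have h' := (mk_gX_eq_iff hm' _ _).1 h
  rw [halfCircle_seq hn hm, halfCircle_seq hn hm, Prod.mk.injEq, decide_eq_decide] at h'
  have h2 := h'.2
  rw [Nat.even_iff, Nat.even_iff] at h2
  omega

theorem isPaired_gB (hn : 0 < n) (hm : 2 ≤ m) (hm' : Even m) (i) : IsPaired (coarsen (gX n m) (gB n m)) i := by
  obtain ⟨t, rfl⟩ := halfCircleSeq_surjective hn hm hm' i
  by_cases ht : Even t
  · exact ⟨_, halfCircleSeq_succ_ne hn hm hm' t, halfCircleSeq_rel_even hn hm hm' ht⟩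
  · obtain ⟨s, rfl⟩ : ∃ s, t = s + 1 := ⟨t - 1, by rw [Nat.even_iff] at ht; omega⟩
    have hs : Even s := by
      rw [Nat.even_iff] at *
      omega
    exact ⟨_, (halfCircleSeq_succ_ne hn hm hm' s).symm,
      Setoid.symm' _ (halfCircleSeq_rel_even hn hm hm' hs)⟩

theorem isPaired_gA (hn : 0 < n) (hm : 2 ≤ m) (hm' : Even m) (i) : IsPaired (coarsen (gX n m) (gA n m)) i := by
  obtain ⟨t, rfl⟩ := halfCircleSeq_surjective hn hm hm' i
  by_cases ht : Even t
  · rw [← halfCircleSeq_add hn hm hm']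
    obtain ⟨s, hs⟩ : ∃ s, t + 2 * n = s + 1 := ⟨t + 2 * n - 1, by omega⟩
    have hs' : ¬ Even s := by
      rw [Nat.even_iff] at *
      omega
    rw [hs]
    exact ⟨_, (halfCircleSeq_succ_ne hn hm hm' s).symm,
      Setoid.symm' _ (halfCircleSeq_rel_odd hn hm hm' hs')⟩
  · exact ⟨_, halfCircleSeq_succ_ne hn hm hm' t, halfCircleSeq_rel_odd hn hm hm' ht⟩

theorem blocks_coarsen_gA_sup_gB_le (hn : 0 < n) (hm : 2 ≤ m) (hm' : Even m) :
    blocks (coarsen (gX n m) (gA n m) ⊔ coarsen (gX n m) (gB n m)) ≤ 1 := by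
  set u := coarsen (gX n m) (gA n m) ⊔ coarsen (gX n m) (gB n m) with hu
  have hrel : ∀ t, u (halfCircleSeq hn hm 0) (halfCircleSeq hn hm t) := by
    intro t
    induction t with
    | zero => exact u.refl' _
    | succ t ih =>
      refine u.trans' ih ?_
      by_cases ht : Even t
      · exact (le_sup_right : _ ≤ u) (halfCircleSeq_rel_even hn hm hm' ht)
      · exact (le_sup_left : _ ≤ u) (halfCircleSeq_rel_odd hn hm hm' ht)
  have htop : u = ⊤ := by
    rw [Setoid.eq_top_iff]
    intro x y
    obtain ⟨s, rfl⟩ := halfCircleSeq_surjective hn hm hm' x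
    obtain ⟨t, rfl⟩ := halfCircleSeq_surjective hn hm hm' y
    exact u.trans' (u.symm' (hrel s)) (hrel t)
  have := Quotient.subsingleton_iff.2 htop
  exact Finite.card_le_one_iff_subsingleton.2 this

theorem two_mul_sub_one_le_partitionDist (hn : 0 < n) (hm : 2 ≤ m) (hm' : Even m) :
    2 * ((n : ℤ) - 1) ≤ partitionDist (coarsen (gX n m) (gA n m)) (coarsen (gX n m) (gB n m)) := by
  have h := blocks_coarsen_gA_sup_gB_le hn hm hm'
  unfold partitionDist
  rw [blocks_coarsen_gA hm hm', blocks_coarsen_gB hm hm']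
  omega

/-- A partition with a singleton is at total distance at least `2n` from the boundary partitions. -/
theorem two_mul_le_partitionDist_add (hn : 0 < n) (hm : 2 ≤ m) (hm' : Even m) {p : BlockPartition n m} {i}
    (hp : ¬ IsPaired p i) :
    2 * (n : ℤ) ≤ partitionDist (coarsen (gX n m) (gA n m)) p +
      partitionDist p (coarsen (gX n m) (gB n m)) := by
  have h := blocks_sup_add_blocks_sup_le (N := 2 * n) (by omega)
    (halfCircleSeq_surjective hn hm hm') (fun s t => halfCircleSeq_eq hn hm hm')
    (halfCircleSeq_add hn hm hm') (fun t => by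
      by_cases ht : Even t
      · exact Or.inr (halfCircleSeq_rel_even hn hm hm' ht)
      · exact Or.inl (halfCircleSeq_rel_odd hn hm hm' ht))
    (isPaired_gA hn hm hm') (isPaired_gB hn hm hm') hp
  unfold partitionDist
  rw [blocks_coarsen_gA hm hm', blocks_coarsen_gB hm hm', sup_comm _ p]
  omega

end BoundaryPartitions

/-! ### Sums over edges -/

section EdgeSums

variable {V : Type*} {G : SimpleGraph V} {w : Sym2 V → ℝ}

theorem mem_cutSurface {S T : Set V} {x y : V} (h : G.Adj x y) :
    s(x, y) ∈ cutSurface G S T ↔ (x ∈ S ∨ y ∈ S) ∧ (x ∈ T ∨ y ∈ T) := by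
  simp only [cutSurface, edgesAt, Set.mem_inter_iff, Set.mem_ofPred_eq, SimpleGraph.mem_edgeSet, h,
    true_and, Sym2.mem_iff]
  constructor
  · rintro ⟨⟨a, ha, rfl | rfl⟩, ⟨b, hb, rfl | rfl⟩⟩ <;> simp [ha, hb]
  · rintro ⟨h1 | h1, h2 | h2⟩ <;> exact ⟨⟨_, h1, by simp⟩, ⟨_, h2, by simp⟩⟩

variable [Fintype V]

theorem edgeSum_mono {f g : Sym2 V → ℝ} (h : ∀ x y, G.Adj x y → f s(x, y) ≤ g s(x, y)) :
    edgeSum G f ≤ edgeSum G g := by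
  classical
  refine Finset.sum_le_sum fun e he => ?_
  induction e using Sym2.ind with
  | _ x y => exact h x y (by simpa using he)

theorem edgeSum_congr {f g : Sym2 V → ℝ} (h : ∀ x y, G.Adj x y → f s(x, y) = g s(x, y)) :
    edgeSum G f = edgeSum G g :=
  le_antisymm (edgeSum_mono fun x y hxy => (h x y hxy).le)
    (edgeSum_mono fun x y hxy => (h x y hxy).ge)

theorem edgeSum_weight_mono (hw : ∀ e ∈ G.edgeSet, 0 ≤ w e) {f g : Sym2 V → ℝ}
    (h : ∀ x y, G.Adj x y → f s(x, y) ≤ g s(x, y)) :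
    edgeSum G (fun e => w e * f e) ≤ edgeSum G (fun e => w e * g e) :=
  edgeSum_mono fun x y hxy => mul_le_mul_of_nonneg_left (h x y hxy) (hw _ hxy)

theorem edgeSum_add (f g : Sym2 V → ℝ) :
    edgeSum G (fun e => f e + g e) = edgeSum G f + edgeSum G g := Finset.sum_add_distrib

theorem mul_edgeSum (c : ℝ) (f : Sym2 V → ℝ) : c * edgeSum G f = edgeSum G (fun e => c * f e) :=
  Finset.mul_sum _ _ _

theorem sum_edgeSum {ι : Type*} (s : Finset ι) (f : ι → Sym2 V → ℝ) :
    ∑ i ∈ s, edgeSum G (f i) = edgeSum G (fun e => ∑ i ∈ s, f i e) := Finset.sum_comm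

open Classical in
/-- The indicator function of `μ(S : T)`. -/
noncomputable def cutIndicator (G : SimpleGraph V) (S T : Set V) (e : Sym2 V) : ℝ :=
  if e ∈ cutSurface G S T then 1 else 0

theorem weight_cutSurface (S T : Set V) :
    weight G w (cutSurface G S T) = edgeSum G fun e => w e * cutIndicator G S T e := by
  classical
  simp [weight, edgeSum, cutIndicator, Finset.sum_filter]

theorem cutArea_eq (r : Set V) :
    cutArea G w r = edgeSum G fun e => w e * cutIndicator G r rᶜ e := weight_cutSurface _ _

theorem triwayArea_eq (tAB tBC tCA : ℝ) (α β γ : Set V) :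
    triwayArea G w tAB tBC tCA α β γ = edgeSum G fun e => w e *
      (tAB * cutIndicator G α β e + tBC * cutIndicator G β γ e + tCA * cutIndicator G γ α e) := by
  rw [triwayArea, weight_cutSurface, weight_cutSurface, weight_cutSurface, mul_edgeSum, mul_edgeSum,
    mul_edgeSum, ← edgeSum_add, ← edgeSum_add]
  congr 1
  ext e
  ring

theorem cutArea_compl (r : Set V) : cutArea G w rᶜ = cutArea G w r := by
  rw [cutArea, cutArea, compl_compl, cutSurface, cutSurface, Set.inter_comm]

theorem cutValues_finite (A B : Set V) : (cutValues G w A B).Finite :=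
  (Set.finite_range (cutArea G w)).subset fun _ ⟨r, _, hr⟩ => ⟨r, hr⟩

theorem isLeast_sInf_of_finite {s : Set ℝ} (hs : s.Finite) (hne : s.Nonempty) :
    IsLeast s (sInf s) :=
  ⟨hne.csInf_mem hs, fun _ ha => csInf_le hs.bddBelow ha⟩

theorem isLeast_minCut {A B : Set V} (h : Disjoint A B) :
    IsLeast (cutValues G w A B) (minCut G w A B) :=
  isLeast_sInf_of_finite (cutValues_finite A B)
    ⟨_, A, ⟨subset_rfl, h.subset_compl_left⟩, rfl⟩

theorem isLeast_minTriwayCut {A B C : Set V} (hAB : Disjoint A B) (hBC : Disjoint B C)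
    (hCA : Disjoint C A) (tAB tBC tCA : ℝ) :
    IsLeast (triwayValues G w tAB tBC tCA A B C) (minTriwayCut G w tAB tBC tCA A B C) := by
  refine isLeast_sInf_of_finite ?_ ?_
  · refine (Set.finite_range fun x : Set V × Set V × Set V =>
      triwayArea G w tAB tBC tCA x.1 x.2.1 x.2.2).subset ?_
    rintro _ ⟨α, β, γ, _, h⟩
    exact ⟨(α, β, γ), h⟩
  · refine ⟨_, A, B, (A ∪ B)ᶜ, ⟨Set.union_compl_self _, hAB, ?_, ?_, subset_rfl, subset_rfl, ?_⟩, rfl⟩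
    · exact (Set.disjoint_compl_right_iff_subset.2 Set.subset_union_right)
    · exact (Set.disjoint_compl_right_iff_subset.2 Set.subset_union_left).symm
    · rw [Set.subset_compl_iff_disjoint_right]
      exact Disjoint.union_right hCA hBC.symm

/-- Complementation exchanges the two sides; the set `rC` is a cut for `C : AB`, while `minCut` is
taken for `AB : C`. -/
theorem IsMinCut.area_eq {A B r : Set V} (h : IsMinCut G w A B r) :
    cutArea G w r = minCut G w B A := by
  have hcompl : ∀ {A B r : Set V}, IsCut A B r → IsCut B A rᶜ := fun h =>
    ⟨h.2, by rw [compl_compl]; exact h.1⟩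
  apply le_antisymm
  · refine le_csInf (s := cutValues G w B A) ⟨_, rᶜ, hcompl h.1, rfl⟩ ?_
    rintro _ ⟨s, hs, rfl⟩
    rw [← cutArea_compl s]
    exact h.2 _ (hcompl hs)
  · exact csInf_le (cutValues_finite _ _).bddBelow ⟨_, hcompl h.1, cutArea_compl r⟩

theorem exists_isMinCut {A B : Set V} (h : Disjoint A B) : ∃ r, IsMinCut G w A B r := by
  obtain ⟨⟨r, hr, he⟩, hle⟩ := isLeast_minCut (G := G) (w := w) h
  exact ⟨r, hr, fun s hs => he.trans_le (hle ⟨s, hs, rfl⟩)⟩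

/-- The cut function is submodular. -/
theorem cutArea_submodular (hw : ∀ e ∈ G.edgeSet, 0 ≤ w e) (r s : Set V) :
    cutArea G w (r ∪ s) + cutArea G w (r ∩ s) ≤ cutArea G w r + cutArea G w s := by
  classical
  simp only [cutArea_eq, ← edgeSum_add, ← mul_add]
  refine edgeSum_weight_mono hw fun x y hxy => ?_
  simp only [cutIndicator, mem_cutSurface hxy, Set.mem_union, Set.mem_inter_iff, Set.mem_compl_iff]
  by_cases h1 : x ∈ r <;> by_cases h2 : x ∈ s <;> by_cases h3 : y ∈ r <;> by_cases h4 : y ∈ s <;>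
    simp [h1, h2, h3, h4]

/-- The indicator function of the event that the threshold `j` separates `a` and `b`. -/
noncomputable def threshold (a b j : ℕ) : ℝ := if a < j ∧ j ≤ b ∨ b < j ∧ j ≤ a then 1 else 0

theorem threshold_comm (a b j : ℕ) : threshold a b j = threshold b a j := by
  simp only [threshold, or_comm]

/-- The number of thresholds that separate two numbers is at most their difference. -/
theorem sum_threshold_le (a b N : ℕ) :
    ∑ j ∈ Finset.Icc 1 N, threshold a b j ≤ |(a : ℝ) - b| := by
  wlog hab : a ≤ b generalizing a b
  · have h := this b a (by omega)
    rw [abs_sub_comm] at h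
    simpa only [threshold_comm a b] using h
  simp only [threshold]
  rw [Finset.sum_boole]
  have hsub : (Finset.Icc 1 N).filter (fun j => a < j ∧ j ≤ b ∨ b < j ∧ j ≤ a) ⊆
      Finset.Ioc a b := by
    intro j hj
    simp only [Finset.mem_filter, Finset.mem_Icc, Finset.mem_Ioc] at hj ⊢
    omega
  have h := Finset.card_le_card hsub
  rw [Nat.card_Ioc] at h
  rw [abs_sub_comm, abs_of_nonneg (by simpa using hab)]
  rw [← Nat.cast_sub hab]
  exact_mod_cast h

/-- A potential that drops by `K` costs at least as much as `K` minimal cuts. -/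
theorem mul_minCut_le (hw : ∀ e ∈ G.edgeSet, 0 ≤ w e) {S T : Set V} {K : ℕ} {f : V → ℕ}
    (hS : ∀ x ∈ S, f x = K) (hT : ∀ x ∈ T, f x = 0) {d : Sym2 V → ℝ}
    (hd : ∀ x y, G.Adj x y → |(f x : ℝ) - f y| ≤ d s(x, y)) :
    K * minCut G w S T ≤ edgeSum G fun e => w e * d e := by
  classical
  -- The `K` superlevel sets of `f` are cuts, and an edge lies on the boundary of at most `|f x - f
  -- y|` of them.
  have h1 : ∀ j ∈ Finset.Icc 1 K, minCut G w S T ≤ cutArea G w {x | j ≤ f x} := by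
    intro j hj
    rw [Finset.mem_Icc] at hj
    refine csInf_le (cutValues_finite _ _).bddBelow ⟨_, ⟨fun x hx => ?_, fun x hx => ?_⟩, rfl⟩
    · simpa [hS x hx] using hj.2
    · have := hT x hx
      simp only [Set.mem_compl_iff, Set.mem_ofPred_eq]
      omega
  have h2 := Finset.card_nsmul_le_sum _ _ _ h1
  rw [Nat.card_Icc, Nat.add_sub_cancel, nsmul_eq_mul] at h2
  refine h2.trans ?_
  simp only [cutArea_eq]
  rw [sum_edgeSum]
  simp only [← Finset.mul_sum]
  refine edgeSum_weight_mono hw fun x y hxy => le_trans ?_ (hd x y hxy)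
  refine le_trans (le_of_eq ?_) (sum_threshold_le (f x) (f y) K)
  refine Finset.sum_congr rfl fun j _ => ?_
  simp only [cutIndicator, threshold, mem_cutSurface hxy, Set.mem_ofPred_eq, Set.mem_compl_iff]
  congr 1
  rw [eq_iff_iff]
  constructor
  · rintro ⟨h1, h2⟩
    omega
  · intro h
    omega

end EdgeSums

/-! ### Walks -/

section Walks

variable {V : Type*} {G : SimpleGraph V}

theorem walkSum_nil (x : V) (r : Sym2 V → ℕ) : walkSum (SimpleGraph.Walk.nil : G.Walk x x) r = 0 := rfl

theorem walkSum_cons {x y z : V} (h : G.Adj x y) (L : G.Walk y z) (r : Sym2 V → ℕ) :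
    walkSum (L.cons h) r = r s(x, y) + walkSum L r := by
  simp [walkSum]

theorem walkSum_append {x y z : V} (L : G.Walk x y) (M : G.Walk y z) (r : Sym2 V → ℕ) :
    walkSum (L.append M) r = walkSum L r + walkSum M r := by
  simp [walkSum]

theorem walkSum_append_edge {x y z : V} (L : G.Walk x y) (h : G.Adj y z) (r : Sym2 V → ℕ) :
    walkSum (L.append (h.toWalk)) r = walkSum L r + r s(y, z) := by
  rw [walkSum_append]
  simp [SimpleGraph.Adj.toWalk, walkSum_cons, walkSum_nil]

theorem walkSum_add {x y : V} (L : G.Walk x y) (r s : Sym2 V → ℕ) :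
    walkSum L (fun e => r e + s e) = walkSum L r + walkSum L s := by
  simp [walkSum, List.sum_map_add]

end Walks

/-! ### Rounding a feasible point of the integer program to a triway cut -/

section Distances

variable {V : Type*} {G : SimpleGraph V}

/-- The `c`-distance from `S`, cut off at `N`, along the walks whose `ρ`-length satisfies `P`. -/
noncomputable def walkDist (G : SimpleGraph V) (S : Set V) (c ρ : Sym2 V → ℕ) (P : ℕ → Prop) (N : ℕ)
    (x : V) : ℕ :=
  sInf {k | k = N ∨ ∃ a ∈ S, ∃ L : G.Walk a x, P (walkSum L ρ) ∧ walkSum L c = k}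

variable {S : Set V} {c ρ : Sym2 V → ℕ} {P Q : ℕ → Prop} {N : ℕ}

theorem walkDist_le_cap (x : V) : walkDist G S c ρ P N x ≤ N := Nat.sInf_le (Or.inl rfl)

theorem walkDist_le {a x : V} (ha : a ∈ S) (L : G.Walk a x) (hL : P (walkSum L ρ)) :
    walkDist G S c ρ P N x ≤ walkSum L c := Nat.sInf_le (Or.inr ⟨a, ha, L, hL, rfl⟩)

theorem walkDist_cases (x : V) : walkDist G S c ρ P N x = N ∨
    ∃ a ∈ S, ∃ L : G.Walk a x, P (walkSum L ρ) ∧ walkSum L c = walkDist G S c ρ P N x :=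
  Nat.sInf_mem (s := {k | k = N ∨ ∃ a ∈ S, ∃ L : G.Walk a x, P (walkSum L ρ) ∧ walkSum L c = k})
    ⟨N, Or.inl rfl⟩

theorem le_walkDist {x : V} {k : ℕ} (hN : k ≤ N)
    (h : ∀ a ∈ S, ∀ L : G.Walk a x, P (walkSum L ρ) → k ≤ walkSum L c) :
    k ≤ walkDist G S c ρ P N x := by
  rcases walkDist_cases (G := G) (S := S) (c := c) (ρ := ρ) (P := P) (N := N) x with h1 | ⟨a, ha, L, hL, h1⟩
  · rw [h1]; exact hN
  · rw [← h1]; exact h a ha L hL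

/-- A value below the cap is realized by a walk, which the edge extends. Two conditions and two caps
are allowed so that walks with `ρ`-length zero can be continued to walks with positive `ρ`-length.
-/
theorem walkDist_step {x y : V} {N' : ℕ} (h : G.Adj x y) (hPQ : ∀ k, P k → Q (k + ρ s(x, y)))
    (hlt : walkDist G S c ρ P N x < N) :
    walkDist G S c ρ Q N' y ≤ walkDist G S c ρ P N x + c s(x, y) := by
  rcases walkDist_cases (G := G) (S := S) (c := c) (ρ := ρ) (P := P) (N := N) x with h1 | ⟨a, ha, L, hL, h1⟩
  · omega
  · rw [← h1, ← walkSum_append_edge L h]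
    exact walkDist_le ha _ (by rw [walkSum_append_edge]; exact hPQ _ hL)

theorem walkDist_step_of_cap {x y : V} (h : G.Adj x y) (hP : ∀ k, P k → P (k + ρ s(x, y))) :
    walkDist G S c ρ P N y ≤ walkDist G S c ρ P N x + c s(x, y) := by
  by_cases hlt : walkDist G S c ρ P N x < N
  · exact walkDist_step h hP hlt
  · have := walkDist_le_cap (G := G) (S := S) (c := c) (ρ := ρ) (P := P) (N := N) y
    omega

end Distances

/-! ### Rounding potentials by two thresholds -/

section Rounding

variable {V : Type*} {G : SimpleGraph V}

/-- A vertex carries the interval from `L` to `H`, which lies above the threshold, lies below it or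
straddles it. Each end that crosses `U` along the edge pays `n`; between the two outer regions both
cross, which covers the tension `2(n-1)`. -/
theorem triwayCost_le {n : ℕ} (hn : 1 ≤ n) {L H : V → ℕ} (hLH : ∀ x, L x ≤ H x) (U : ℕ) {x y : V}
    (h : G.Adj x y) :
    2 * ((n : ℝ) - 1) * cutIndicator G {v | U ≤ L v} {v | H v < U} s(x, y)
        + n * cutIndicator G {v | H v < U} {v | L v < U ∧ U ≤ H v} s(x, y)
        + n * cutIndicator G {v | L v < U ∧ U ≤ H v} {v | U ≤ L v} s(x, y) ≤
      n * (threshold (L x) (L y) U + threshold (H x) (H y) U) := by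
  classical
  have h1 := hLH x
  have h2 := hLH y
  have hn' : (1 : ℝ) ≤ n := by exact_mod_cast hn
  simp only [cutIndicator, threshold, mem_cutSurface h, Set.mem_ofPred_eq]
  split_ifs <;> first | omega | linarith

/-- Degenerate intervals never straddle the threshold, so only the tension `2(n-1)` is paid. -/
theorem triwayCost_le_of_eq {n : ℕ} (hn : 1 ≤ n) {L H : V → ℕ} (U : ℕ) {x y : V} (hx : L x = H x)
    (hy : L y = H y) (h : G.Adj x y) :
    2 * ((n : ℝ) - 1) * cutIndicator G {v | U ≤ L v} {v | H v < U} s(x, y)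
        + n * cutIndicator G {v | H v < U} {v | L v < U ∧ U ≤ H v} s(x, y)
        + n * cutIndicator G {v | L v < U ∧ U ≤ H v} {v | U ≤ L v} s(x, y) ≤
      2 * ((n : ℝ) - 1) * threshold (L x) (L y) U := by
  classical
  have hn' : (1 : ℝ) ≤ n := by exact_mod_cast hn
  simp only [cutIndicator, threshold, mem_cutSurface h, Set.mem_ofPred_eq]
  split_ifs <;> first | omega | linarith

/-- The level that decides about the region of a vertex. -/
def roundingLevel (τ qz qe : V → ℕ) (T : ℕ) (x : V) : ℕ :=
  if τ x = 0 then max (qe x) (if T ≤ qz x then qz x + 2 else qz x) else max (qe x) (τ x)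

theorem le_roundingLevel (τ qz qe : V → ℕ) (T : ℕ) (x : V) : τ x ≤ roundingLevel τ qz qe T x := by
  unfold roundingLevel
  split_ifs <;> omega

/-- Potentials with these properties can be rounded to a triway cut by two independent uniform
thresholds `T` and `U`. -/
theorem exists_triwayCut_le_of_potentials [Fintype V] {w : Sym2 V → ℝ}
    (hw : ∀ e ∈ G.edgeSet, 0 ≤ w e) {A B C : Set V} {n : ℕ} (hn : 2 ≤ n) {τ qz qe : V → ℕ}
    {ρ r : Sym2 V → ℕ} (hρr : ∀ e, ρ e ≤ r e)
    (hA : ∀ x ∈ A, τ x = 0 ∧ qz x = 2 * n - 2) (hB : ∀ x ∈ B, τ x = 0 ∧ qz x = 0 ∧ qe x = 0)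
    (hC : ∀ x ∈ C, τ x = n ∧ qe x ≤ n)
    (hτ : ∀ x y, G.Adj x y → τ x ≤ τ y + ρ s(x, y))
    (he : ∀ x y, G.Adj x y → qe x ≤ qe y + r s(x, y))
    (hz : ∀ x y, G.Adj x y → ρ s(x, y) = 0 → qz x ≤ qz y + r s(x, y))
    (hze : ∀ x y, G.Adj x y → ρ s(x, y) ≠ 0 → qz x ≠ 0 → qz x + 2 ≤ qe y + r s(x, y)) :
    ∃ α β γ, IsTriwayCut A B C α β γ ∧
      triwayArea G w (2 * ((n : ℝ) - 1)) n n α β γ ≤ edgeSum G fun e => w e * r e := by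
  set S := roundingLevel τ qz qe with hS
  let L : ℕ → V → ℕ := fun T x => S T x - τ x
  let H : ℕ → V → ℕ := fun T x => S T x + τ x
  have hτS : ∀ T x, τ x ≤ S T x := le_roundingLevel τ qz qe
  have hLH : ∀ T x, L T x ≤ H T x := fun T x => by simp only [L, H]; omega
  let cost : ℕ → ℕ → Sym2 V → ℝ := fun T U e =>
    2 * ((n : ℝ) - 1) * cutIndicator G {v | U ≤ L T v} {v | H T v < U} e
        + n * cutIndicator G {v | H T v < U} {v | L T v < U ∧ U ≤ H T v} e
        + n * cutIndicator G {v | L T v < U ∧ U ≤ H T v} {v | U ≤ L T v} e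
  have hn' : (2 : ℝ) ≤ n := by exact_mod_cast hn
  have hcard : ((2 * n - 2 : ℕ) : ℝ) = 2 * ((n : ℝ) - 1) := by
    rw [Nat.cast_sub (by omega)]
    push_cast
    ring
  have hρr' : ∀ e, (ρ e : ℝ) ≤ r e := fun e => by exact_mod_cast hρr e
  -- The bound for a single edge: the average of its cost over the `(2n-2) * 2n` pairs of thresholds
  -- is at most `r`.
  have hcost : ∀ x y, G.Adj x y →
      ∑ T ∈ Finset.Icc 1 (2 * n - 2), ∑ U ∈ Finset.Icc 1 (2 * n), cost T U s(x, y) ≤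
        2 * ((n : ℝ) - 1) * (2 * n) * r s(x, y) := by
    intro x y hxy
    have hτ1 := hτ x y hxy
    have hτ2 := hτ y x hxy.symm
    have he1 := he x y hxy
    have he2 := he y x hxy.symm
    have hz1 := hz x y hxy
    have hz2 := hz y x hxy.symm
    have hze1 := hze x y hxy
    have hze2 := hze y x hxy.symm
    have hle := hρr s(x, y)
    rw [Sym2.eq_swap] at hτ2 he2 hz2 hze2
    by_cases hcase : τ x = 0 ∧ τ y = 0 ∧ ρ s(x, y) = 0
    · obtain ⟨hx, hy, h0⟩ := hcase
      -- Between these vertices the level changes by at most `r`, plus a jump of `2` if `T`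
      -- separates the values of `qz`. At most `r` of the `2n-2` values of `T` do so, and the
      -- resulting factor `2n/(2n-2)` is compensated by the lower tension.
      have h1 : ∀ T ∈ Finset.Icc 1 (2 * n - 2), ∑ U ∈ Finset.Icc 1 (2 * n), cost T U s(x, y) ≤
          2 * ((n : ℝ) - 1) * (r s(x, y) + 2 * threshold (qz x) (qz y) T) := by
        intro T _
        have h2 : ∀ U ∈ Finset.Icc 1 (2 * n), cost T U s(x, y) ≤
            2 * ((n : ℝ) - 1) * threshold (S T x) (S T y) U := by
          intro U _
          have h3 := triwayCost_le_of_eq (n := n) (by omega) (L := L T) (H := H T) U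
            (by simp only [L, H]; omega) (by simp only [L, H]; omega) hxy
          have h4 : L T x = S T x := by simp only [L]; omega
          have h5 : L T y = S T y := by simp only [L]; omega
          rw [h4, h5] at h3
          exact h3
        refine (Finset.sum_le_sum h2).trans ?_
        rw [← Finset.mul_sum]
        refine mul_le_mul_of_nonneg_left ((sum_threshold_le _ _ _).trans ?_) (by linarith)
        have h6 : S T x ≤ S T y + r s(x, y) +
            2 * (if qz x < T ∧ T ≤ qz y ∨ qz y < T ∧ T ≤ qz x then 1 else 0) := by
          simp only [hS, roundingLevel, hx, hy, if_true]
          have := hz1 h0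
          split_ifs <;> omega
        have h7 : S T y ≤ S T x + r s(x, y) +
            2 * (if qz x < T ∧ T ≤ qz y ∨ qz y < T ∧ T ≤ qz x then 1 else 0) := by
          simp only [hS, roundingLevel, hx, hy, if_true]
          have := hz2 h0
          split_ifs <;> omega
        have h8 : (S T x : ℝ) ≤ S T y + r s(x, y) + 2 * threshold (qz x) (qz y) T := by
          unfold threshold
          exact_mod_cast h6
        have h9 : (S T y : ℝ) ≤ S T x + r s(x, y) + 2 * threshold (qz x) (qz y) T := by
          unfold threshold
          exact_mod_cast h7
        exact abs_le.2 ⟨by linarith, by linarith⟩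
      refine (Finset.sum_le_sum h1).trans ?_
      rw [← Finset.mul_sum, Finset.sum_add_distrib, ← Finset.mul_sum, Finset.sum_const, Nat.card_Icc,
        Nat.add_sub_cancel, nsmul_eq_mul, hcard, mul_assoc (2 * ((n : ℝ) - 1))]
      refine mul_le_mul_of_nonneg_left ?_ (by linarith)
      have h10 := sum_threshold_le (qz x) (qz y) (2 * n - 2)
      have h11 : (qz x : ℝ) ≤ qz y + r s(x, y) := by exact_mod_cast hz1 h0
      have h12 : (qz y : ℝ) ≤ qz x + r s(x, y) := by exact_mod_cast hz2 h0
      have h13 : |(qz x : ℝ) - qz y| ≤ r s(x, y) := abs_le.2 ⟨by linarith, by linarith⟩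
      linarith
    -- Here the level changes by at most `r` for every `T`: the jump by `2` is absorbed by `hze`,
    -- which applies as `1 ≤ T ≤ qz x`. The changes of `L` and `H` then add up to twice the larger
    -- of the changes of level and `τ`, which is at most `2r`.
    · have h1 : ∀ T ∈ Finset.Icc 1 (2 * n - 2), ∑ U ∈ Finset.Icc 1 (2 * n), cost T U s(x, y) ≤
          (2 * n) * r s(x, y) := by
        intro T hT
        rw [Finset.mem_Icc] at hT
        have h2 : ∀ U ∈ Finset.Icc 1 (2 * n), cost T U s(x, y) ≤
            n * (threshold (L T x) (L T y) U + threshold (H T x) (H T y) U) := fun U _ =>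
          triwayCost_le (by omega) (hLH T) U hxy
        refine (Finset.sum_le_sum h2).trans ?_
        rw [← Finset.mul_sum, Finset.sum_add_distrib, mul_comm (2 : ℝ), mul_assoc]
        refine mul_le_mul_of_nonneg_left ?_ (by linarith)
        have h3 := sum_threshold_le (L T x) (L T y) (2 * n)
        have h4 := sum_threshold_le (H T x) (H T y) (2 * n)
        have h5 : S T x ≤ S T y + r s(x, y) := by
          simp only [hS, roundingLevel]
          split_ifs <;> omega
        have h6 : S T y ≤ S T x + r s(x, y) := by
          simp only [hS, roundingLevel]
          split_ifs <;> omega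
        have h5' : (S T x : ℝ) ≤ S T y + r s(x, y) := by exact_mod_cast h5
        have h6' : (S T y : ℝ) ≤ S T x + r s(x, y) := by exact_mod_cast h6
        have h7' : (τ x : ℝ) ≤ τ y + r s(x, y) := by exact_mod_cast (by omega : τ x ≤ τ y + r s(x, y))
        have h8' : (τ y : ℝ) ≤ τ x + r s(x, y) := by exact_mod_cast (by omega : τ y ≤ τ x + r s(x, y))
        have hLx : ∀ x, (L T x : ℝ) = S T x - τ x := fun x => Nat.cast_sub (hτS T x)
        have hHx : ∀ x, (H T x : ℝ) = S T x + τ x := fun x => Nat.cast_add _ _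
        rw [hLx, hLx] at h3
        rw [hHx, hHx] at h4
        refine (add_le_add h3 h4).trans ?_
        rcases abs_cases ((S T x : ℝ) - τ x - (S T y - τ y)) with h | h <;>
          rcases abs_cases ((S T x : ℝ) + τ x - (S T y + τ y)) with h' | h' <;> linarith
      refine (Finset.sum_le_sum h1).trans ?_
      rw [Finset.sum_const, Nat.card_Icc, Nat.add_sub_cancel, nsmul_eq_mul, hcard, mul_assoc]
      simp only [mul_assoc, le_refl]
  have hsum : ∑ p ∈ Finset.Icc 1 (2 * n - 2) ×ˢ Finset.Icc 1 (2 * n),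
      triwayArea G w (2 * ((n : ℝ) - 1)) n n {v | p.2 ≤ L p.1 v} {v | H p.1 v < p.2}
        {v | L p.1 v < p.2 ∧ p.2 ≤ H p.1 v} ≤
      ∑ _p ∈ Finset.Icc 1 (2 * n - 2) ×ˢ Finset.Icc 1 (2 * n), edgeSum G fun e => w e * r e := by
    rw [Finset.sum_const, Finset.card_product, Nat.card_Icc, Nat.card_Icc, nsmul_eq_mul,
      Finset.sum_product]
    simp only [triwayArea_eq, sum_edgeSum, ← Finset.mul_sum]
    rw [mul_edgeSum, Nat.add_sub_cancel, Nat.add_sub_cancel, Nat.cast_mul, hcard]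
    refine (edgeSum_weight_mono hw
      (g := fun e => 2 * ((n : ℝ) - 1) * (2 * n) * r e) hcost).trans (le_of_eq ?_)
    congr 1
    ext e
    push_cast
    ring
  obtain ⟨⟨T, U⟩, hTU, hle⟩ := Finset.exists_le_of_sum_le
    ⟨(1, 1), by simp only [Finset.mem_product, Finset.mem_Icc]; omega⟩ hsum
  simp only [Finset.mem_product, Finset.mem_Icc] at hTU
  refine ⟨_, _, _, ⟨?_, ?_, ?_, ?_, ?_, ?_, ?_⟩, hle⟩
  · ext v
    simp only [Set.mem_union, Set.mem_ofPred_eq, Set.mem_univ, iff_true]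
    omega
  · rw [Set.disjoint_left]
    intro v h1 h2
    simp only [Set.mem_ofPred_eq] at h1 h2
    have := hLH T v
    omega
  · rw [Set.disjoint_left]
    intro v h1 h2
    simp only [Set.mem_ofPred_eq] at h1 h2
    omega
  · rw [Set.disjoint_left]
    intro v h1 h2
    simp only [Set.mem_ofPred_eq] at h1 h2
    omega
  -- The thresholds satisfy `1 ≤ T ≤ 2n-2` and `1 ≤ U ≤ 2n`. On `A` the interval starts at `2n` or
  -- higher, on `B` it is the point `0`, and on `C` it runs from `0` to `2n`.
  · intro x hx
    obtain ⟨h1, h2⟩ := hA x hx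
    simp only [Set.mem_ofPred_eq, L, hS, roundingLevel, h1, if_true]
    split_ifs <;> omega
  · intro x hx
    obtain ⟨h1, h2, h3⟩ := hB x hx
    simp only [Set.mem_ofPred_eq, H, hS, roundingLevel, h1, if_true]
    split_ifs <;> omega
  · intro x hx
    obtain ⟨h1, h2⟩ := hC x hx
    simp only [Set.mem_ofPred_eq, L, H, hS, roundingLevel]
    split_ifs <;> omega

/-- Every feasible point of the integer program bounds a triway cut. -/
theorem exists_triwayCut_le [Fintype V] {w : Sym2 V → ℝ} (hw : ∀ e ∈ G.edgeSet, 0 ≤ w e)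
    {A B C : Set V} {n : ℕ} (hn : 2 ≤ n) {ρ σ : Sym2 V → ℕ}
    (h : IntConstraints n G A B C ρ σ) :
    ∃ α β γ, IsTriwayCut A B C α β γ ∧ triwayArea G w (2 * ((n : ℝ) - 1)) n n α β γ ≤
      edgeSum G fun e => w e * ((σ e : ℝ) + ρ e) := by
  let r : Sym2 V → ℕ := fun e => σ e + ρ e
  obtain ⟨hAB, hC⟩ := h
  have hρr : ∀ {x y : V} (L : G.Walk x y), walkSum L ρ ≤ walkSum L r := fun L => by
    simp only [r, walkSum_add]
    omega
  -- `z` and `d` separate the walks from `A` by whether `ρ` vanishes on them. The caps are the lower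
  -- bounds `2n-2` and `2n` for such walks to `B`, so that both `z` and `d` reach their caps on `B`.
  let τ := walkDist G (A ∪ B) ρ ρ (fun _ => True) n
  let z := walkDist G A r ρ (fun k => k = 0) (2 * n - 2)
  let d := walkDist G A r ρ (fun k => k ≠ 0) (2 * n)
  have hz_cap : ∀ x, z x ≤ 2 * n - 2 := walkDist_le_cap
  have hd_cap : ∀ x, d x ≤ 2 * n := walkDist_le_cap
  have hτ0 : ∀ x ∈ A ∪ B, τ x = 0 := fun x hx =>
    Nat.le_zero.1 (walkDist_le hx SimpleGraph.Walk.nil trivial)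
  have key := exists_triwayCut_le_of_potentials (G := G) hw (A := A) (B := B) (C := C) hn (τ := τ)
    (qz := fun x => 2 * n - 2 - z x) (qe := fun x => 2 * n - d x) (ρ := ρ) (r := r)
    (fun e => Nat.le_add_left _ _) ?_ ?_ ?_ ?_ ?_ ?_ ?_
  · obtain ⟨α, β, γ, hcut, hle⟩ := key
    refine ⟨α, β, γ, hcut, hle.trans (le_of_eq ?_)⟩
    simp [r]
  · intro x hx
    have hz0 : z x = 0 := Nat.le_zero.1 (walkDist_le hx SimpleGraph.Walk.nil rfl)
    exact ⟨hτ0 x (Or.inl hx), by omega⟩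
  · intro x hx
    have h1 : 2 * n - 2 ≤ z x := le_walkDist le_rfl fun a ha L hL => by
      obtain ⟨j, hj⟩ := hAB a ha x hx L
      rw [if_pos hL] at hj
      simp only [r]
      omega
    have h2 : 2 * n ≤ d x := le_walkDist le_rfl fun a ha L hL => by
      obtain ⟨j, hj⟩ := hAB a ha x hx L
      rw [if_neg hL] at hj
      simp only [r]
      omega
    exact ⟨hτ0 x (Or.inr hx), by omega, by omega⟩
  · intro x hx
    have h1 : n ≤ τ x := le_walkDist le_rfl fun a ha L _ => hC a ha x hx L
    have h2 : τ x ≤ n := walkDist_le_cap x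
    have h3 : n ≤ d x := le_walkDist (by omega) fun a ha L _ =>
      (hC a (Or.inl ha) x hx L).trans (hρr L)
    exact ⟨by omega, by omega⟩
  · intro x y hxy
    have h1 := walkDist_step_of_cap (S := A ∪ B) (c := ρ) (ρ := ρ) (P := fun _ => True) (N := n)
      hxy.symm fun _ _ => trivial
    rwa [Sym2.eq_swap] at h1
  · intro x y hxy
    have h1 : d y ≤ d x + r s(x, y) := walkDist_step_of_cap hxy fun _ _ => by omega
    omega
  · intro x y hxy h0
    have h1 : z y ≤ z x + r s(x, y) := walkDist_step_of_cap hxy fun _ _ => by omega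
    omega
  · intro x y hxy h0 hx
    -- `qz x ≠ 0` says that `z` is below its cap at `x`; the edge with `ρ ≠ 0` turns its walk into
    -- one that counts for `d`. The `2` is the difference of the caps.
    have h1 : d y ≤ z x + r s(x, y) := walkDist_step hxy (fun _ _ => by omega) (by
      change z x < 2 * n - 2
      omega)
    have := hz_cap x
    omega

end Rounding

/-! ### Attained minima of programs over vectors of natural numbers -/

section Attained

variable {V : Type*} [Fintype V] {G : SimpleGraph V} {w : Sym2 V → ℝ}

/-- The feasible vectors in `BoolValuesAt` and `IntValues` need not be finite in number. By
Dickson's lemma vectors of natural numbers are well-quasi-ordered, so a monotone objective takes a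
least value. -/
theorem isLeast_sInf_image {α : Type*} [Preorder α] [WellQuasiOrderedLE α] {f : α → ℝ}
    (hf : Monotone f) {s : Set α} (hs : s.Nonempty) : IsLeast (f '' s) (sInf (f '' s)) := by
  have hwf := ((Set.isPWO_of_wellQuasiOrderedLE s).image_of_monotone hf).isWF
  have h : IsLeast (f '' s) (hwf.min (hs.image f)) :=
    ⟨hwf.min_mem _, fun a ha => hwf.min_le _ ha⟩
  rwa [h.csInf_eq]

theorem edgeSum_monotone (hw : ∀ e ∈ G.edgeSet, 0 ≤ w e) :
    Monotone fun r : Sym2 V → ℕ => edgeSum G fun e => w e * r e := fun _ _ h =>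
  edgeSum_weight_mono hw fun x y _ => by exact_mod_cast h s(x, y)

end Attained

/-! ### From set partitions to bit strings -/

section Walks

variable {V : Type*} {G : SimpleGraph V}

theorem walkSum_congr {x y : V} (L : G.Walk x y) {f g : Sym2 V → ℕ}
    (h : ∀ x y, G.Adj x y → f s(x, y) = g s(x, y)) : walkSum L f = walkSum L g := by
  induction L with
  | nil => rfl
  | cons h' L ih => rw [walkSum_cons, walkSum_cons, ih, h _ _ h']

theorem iInf_support_eq_top_iff {n : ℕ} {x y : V} (L : G.Walk x y) (b : V → Fin n → Bool) :
    (⨅ v ∈ L.support, b v) = ⊤ ↔ ∀ v ∈ L.support, b v = ⊤ := by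
  simp only [iInf_eq_top]

/-- The lower bound is the triangle inequality along the walk. The parity statement telescopes,
because a partition distance is congruent to the sum of the two block numbers modulo `2`. -/
theorem exists_walkSum_eq {α : Type*} [Finite α] {q : V → Setoid α} {r : Sym2 V → ℕ}
    (hr : ∀ x y, G.Adj x y → (r s(x, y) : ℤ) = partitionDist (q x) (q y)) {x y : V}
    (L : G.Walk x y) :
    partitionDist (q x) (q y) ≤ walkSum L r ∧
      ∃ k : ℤ, (walkSum L r : ℤ) = blocks (q x) + blocks (q y) + 2 * k := by
  induction L with
  | @nil u =>
    constructor
    · simp [walkSum_nil, partitionDist]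
      omega
    · exact ⟨-blocks (q u), by rw [walkSum_nil]; push_cast; ring⟩
  | @cons u v z h L ih =>
    obtain ⟨ih1, k, hk⟩ := ih
    rw [walkSum_cons]
    push_cast
    rw [hr _ _ h]
    constructor
    · exact (partitionDist_triangle _ (q v) _).trans (by linarith)
    · refine ⟨k + blocks (q v) - blocks (q u ⊔ q v), ?_⟩
      rw [hk, partitionDist]
      ring

/-- The edge function of a distance between the values at the end points. -/
def liftDist {X : Type*} (d : X → X → ℕ) (hd : ∀ a b, d a b = d b a) (q : V → X) : Sym2 V → ℕ :=
  Sym2.lift ⟨fun x y => d (q x) (q y), fun _ _ => hd _ _⟩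

theorem exists_boolConstraints {A B C : Set V} {n m : ℕ} (hn : 2 ≤ n) (hm : 2 ≤ m) (hm' : Even m)
    {q : V → BlockPartition n m} (hq : QFeasible n m A B C q) :
    ∃ (b : V → Fin (2 * n) → Bool) (r : Sym2 V → ℕ), BoolFeasible n A B C b ∧
      BoolConstraints n G A B b r ∧ ∀ x y, (r s(x, y) : ℤ) = partitionDist (q x) (q y) := by
  classical
  obtain ⟨hqA, hqB, hqC⟩ := hq
  have := Fintype.ofFinite (Quotient (cyclePartition (gX n m)))
  let ε : Quotient (cyclePartition (gX n m)) ≃ Fin (2 * n) :=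
    Finite.equivFinOfCardEq (card_halfCircles hm hm')
  let b : V → Fin (2 * n) → Bool := fun x i => decide (IsPaired (q x) (ε.symm i))
  let r := liftDist (fun p p' : BlockPartition n m => (partitionDist p p').toNat)
    (fun p p' => by rw [partitionDist_comm]) q
  have hr : ∀ x y, (r s(x, y) : ℤ) = partitionDist (q x) (q y) := fun x y =>
    Int.toNat_of_nonneg (partitionDist_nonneg _ _)
  refine ⟨b, r, ⟨?_, ?_, ?_⟩, ⟨?_, ?_⟩, hr⟩
  · intro x hx
    ext i
    simp [b, hqA x hx, isPaired_gA (by omega : 0 < n) hm hm']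
  · intro x hx
    ext i
    simp [b, hqB x hx, isPaired_gB (by omega : 0 < n) hm hm']
  · intro x hx
    ext i
    have : ¬ IsPaired (⊥ : BlockPartition n m) (ε.symm i) := by
      rintro ⟨j, hj, h⟩
      exact hj (Eq.symm h)
    simp [b, hqC x hx, this]
  · intro x hx y hy L
    obtain ⟨h1, k, hk⟩ := exists_walkSum_eq (fun x y _ => hr x y) L
    rw [hqA x hx, hqB y hy] at h1
    rw [hqA x hx, hqB y hy, blocks_coarsen_gA hm hm', blocks_coarsen_gB hm hm'] at hk
    have h2 := two_mul_sub_one_le_partitionDist (n := n) (by omega) hm hm'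
    split_ifs with hall
    -- The lower bound makes `k + 1` nonnegative, so `toNat` loses nothing; the shift comes from `2n
    -- = 2(n-1) + 2`.
    · exact ⟨(k + 1).toNat, by omega⟩
    · rw [iInf_support_eq_top_iff] at hall
      push Not at hall
      obtain ⟨v, hv, hbv⟩ := hall
      obtain ⟨i, hi⟩ : ∃ i, b v i ≠ ⊤ := by
        by_contra! hcon
        exact hbv (funext hcon)
      have hi' : ¬ IsPaired (q v) (ε.symm i) := by simpa [b] using hi
      -- `q v` has a singleton. Splitting the walk at `v` bounds its sum by the two distances
      -- through `q v`, hence by `2n`.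
      have h3 := two_mul_le_partitionDist_add (by omega) hm hm' hi'
      have h4 := (exists_walkSum_eq (fun x y _ => hr x y) (L.takeUntil v hv)).1
      have h5 := (exists_walkSum_eq (fun x y _ => hr x y) (L.dropUntil v hv)).1
      have h6 := walkSum_append (L.takeUntil v hv) (L.dropUntil v hv) r
      rw [L.take_spec hv] at h6
      rw [hqA x hx] at h4
      rw [hqB y hy] at h5
      exact ⟨k.toNat, by omega⟩
  · intro x y _
    have h1 := card_isPaired_ne_le (q x) (q y)
    have h2 : hammingDist (b x) (b y) =
        (Finset.univ.filter fun i => ¬ (IsPaired (q x) i ↔ IsPaired (q y) i)).card := by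
      rw [hammingDist]
      refine Finset.card_bij (fun i _ => ε.symm i) ?_ (fun _ _ _ _ h => ε.symm.injective h) ?_
      · intro i hi
        simpa [b] using hi
      · intro i hi
        exact ⟨ε i, by simpa [b] using hi, by simp⟩
    rw [Nat.ceil_le, div_le_iff₀ (by norm_num), h2]
    rw [← hr x y] at h1
    have h3 : (Finset.univ.filter fun i => ¬ (IsPaired (q x) i ↔ IsPaired (q y) i)).card ≤
        r s(x, y) * 2 := by omega
    exact_mod_cast h3

/-! ### From bit strings to the integer program -/

theorem hammingDist_le_walkSum {n : ℕ} {b : V → Fin n → Bool} {ρ : Sym2 V → ℕ}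
    (hρ : ∀ x y, hammingDist (b x) (b y) ≤ 2 * ρ s(x, y)) {x y : V} (L : G.Walk x y) :
    hammingDist (b x) (b y) ≤ 2 * walkSum L ρ := by
  induction L with
  | nil => simp
  | @cons u v z h L ih =>
    have h1 := hammingDist_triangle (b u) (b v) (b z)
    have h2 := hρ u v
    rw [walkSum_cons]
    omega

/-- This matches the two case distinctions in the walk constraints of the Boolean and the integer
program. -/
theorem walkSum_eq_zero_iff {n : ℕ} {b : V → Fin n → Bool} {ρ : Sym2 V → ℕ}
    (hρ : ∀ x y, ρ s(x, y) = 0 ↔ b x = b y) {x y : V} (L : G.Walk x y) (hx : b x = ⊤) :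
    walkSum L ρ = 0 ↔ ∀ v ∈ L.support, b v = ⊤ := by
  induction L with
  | nil => simp [walkSum_nil, hx]
  | @cons u v z h L ih =>
    rw [walkSum_cons, Nat.add_eq_zero_iff, hρ, SimpleGraph.Walk.support_cons, List.forall_mem_cons]
    constructor
    · rintro ⟨h1, h2⟩
      exact ⟨hx, (ih (h1 ▸ hx)).1 h2⟩
    · rintro ⟨_, h2⟩
      have hv : b v = ⊤ := h2 v L.start_mem_support
      exact ⟨hx.trans hv.symm, (ih hv).2 h2⟩

/-- With `ρ` half the Hamming distance rounded up, a walk from `A ∪ B` to `C` must flip all `2n`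
bits and so has `ρ`-length at least `n`. -/
theorem exists_intConstraints {A B C : Set V} {n : ℕ} {b : V → Fin (2 * n) → Bool}
    {r : Sym2 V → ℕ} (hb : BoolFeasible n A B C b) (hr : BoolConstraints n G A B b r) :
    ∃ ρ σ : Sym2 V → ℕ, IntConstraints n G A B C ρ σ ∧
      ∀ x y, G.Adj x y → σ s(x, y) + ρ s(x, y) = r s(x, y) := by
  obtain ⟨hbA, hbB, hbC⟩ := hb
  let ρ := liftDist (fun c c' : Fin (2 * n) → Bool => ⌈(hammingDist c c' : ℚ) / 2⌉₊)
    (fun c c' => by rw [hammingDist_comm]) b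
  have hρ : ∀ x y, ρ s(x, y) = ⌈(hammingDist (b x) (b y) : ℚ) / 2⌉₊ := fun _ _ => rfl
  have hadd : ∀ x y, G.Adj x y → r s(x, y) - ρ s(x, y) + ρ s(x, y) = r s(x, y) := fun x y h =>
    Nat.sub_add_cancel (hr.2 x y h)
  have hρ2 : ∀ x y, hammingDist (b x) (b y) ≤ 2 * ρ s(x, y) := by
    intro x y
    have h := Nat.le_ceil ((hammingDist (b x) (b y) : ℚ) / 2)
    rw [div_le_iff₀ (by norm_num), ← hρ] at h
    have h' : hammingDist (b x) (b y) ≤ ρ s(x, y) * 2 := by exact_mod_cast h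
    omega
  have hρ0 : ∀ x y, ρ s(x, y) = 0 ↔ b x = b y := by
    intro x y
    rw [hρ, Nat.ceil_eq_zero, ← hammingDist_eq_zero, div_le_iff₀ (by norm_num), zero_mul]
    constructor
    · intro h
      exact Nat.le_zero.1 (by exact_mod_cast h)
    · intro h
      rw [h, Nat.cast_zero]
  refine ⟨ρ, fun e => r e - ρ e, ⟨?_, ?_⟩, hadd⟩
  · intro x hx y hy L
    obtain ⟨j, hj⟩ := hr.1 x hx y hy L
    refine ⟨j, ?_⟩
    rw [walkSum_congr L hadd, hj]
    simp only [iInf_support_eq_top_iff, walkSum_eq_zero_iff hρ0 L (hbA x hx)]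
  · intro x hx y hy L
    have h := hammingDist_le_walkSum hρ2 L
    have hx' : b x = ⊤ := hx.elim (hbA x) (hbB x)
    rw [hx', hbC y hy] at h
    have h2 : hammingDist (⊤ : Fin (2 * n) → Bool) ⊥ = 2 * n := by
      simp [hammingDist]
    omega

theorem exists_boolConstraints_of {A B : Set V} (hAB : Disjoint A B) (n : ℕ)
    (b : V → Fin (2 * n) → Bool) : ∃ r, BoolConstraints n G A B b r := by
  -- All walk sums are even, and a walk from `A` to `B` has an edge because these sets are disjoint;
  -- its first edge already pays `2n`.
  refine ⟨fun _ => 2 * n, ?_, ?_⟩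
  · intro x hx y hy L
    cases L with
    | nil => exact absurd hy (Set.disjoint_left.1 hAB hx)
    | @cons _ v _ h L =>
      have h1 : ∀ {u z : V} (L : G.Walk u z), ∃ k, walkSum L (fun _ => 2 * n) = 2 * k := by
        intro u z L
        induction L with
        | nil => exact ⟨0, rfl⟩
        | cons h L ih =>
          obtain ⟨k, hk⟩ := ih
          exact ⟨n + k, by rw [walkSum_cons, hk]; ring⟩
      obtain ⟨k, hk⟩ := h1 L
      rw [walkSum_cons, hk]
      split_ifs
      · exact ⟨k + 1, by push_cast; ring⟩
      · exact ⟨k, by push_cast; ring⟩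
  · intro x y _
    rw [Nat.ceil_le, div_le_iff₀ (by norm_num)]
    have h := hammingDist_le_card_fintype (x := b x) (y := b y)
    rw [Fintype.card_fin] at h
    have h' : hammingDist (b x) (b y) ≤ (2 * n) * 2 := by omega
    exact_mod_cast h'

end Walks

/-! ### Comparison of the optimal values -/

section Comparison

variable {V : Type*} {G : SimpleGraph V} {w : Sym2 V → ℝ} {A B C : Set V} {n m : ℕ}

theorem triway_cases {α β γ : Set V} (hU : α ∪ β ∪ γ = Set.univ) (h1 : Disjoint α β)
    (h2 : Disjoint β γ) (h3 : Disjoint γ α) (x : V) :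
    (x ∈ α ∧ x ∉ β ∧ x ∉ γ) ∨ (x ∉ α ∧ x ∈ β ∧ x ∉ γ) ∨ (x ∉ α ∧ x ∉ β ∧ x ∈ γ) := by
  have hx : x ∈ α ∪ β ∪ γ := hU ▸ Set.mem_univ x
  rw [Set.disjoint_left] at h1 h2 h3
  have e1 := @h1 x
  have e2 := @h2 x
  have e3 := @h3 x
  simp only [Set.mem_union] at hx
  tauto

theorem rFeasible_cutConfig {α β γ rC : Set V} (hcut : IsTriwayCut A B C α β γ) (hC : C ⊆ rC)
    (hr : rC ⊆ γ) : RFeasible n m A B C (cutConfig n m α β rC) := by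
  obtain ⟨hU, h1, h2, h3, hA, hB, -⟩ := hcut
  refine ⟨fun x hx => ?_, fun x hx => ?_, fun x hx => ?_⟩
  · simp [cutConfig, hA hx]
  · simp [cutConfig, hB hx, Set.disjoint_right.1 h1 (hB hx)]
  · simp [cutConfig, hC hx, Set.disjoint_left.1 h3 (hr (hC hx)),
      Set.disjoint_right.1 h2 (hr (hC hx))]

theorem qFeasible_coarsen {g : V → ReplicaPerm n m} (hg : RFeasible n m A B C g) :
    QFeasible n m A B C fun x => coarsen (gX n m) (g x) := by
  obtain ⟨hA, hB, hC⟩ := hg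
  exact ⟨fun x hx => congrArg (coarsen _) (hA x hx), fun x hx => congrArg (coarsen _) (hB x hx),
    fun x hx => (congrArg (coarsen _) (hC x hx)).trans (coarsen_one _)⟩

variable [Fintype V]

/-- Uncrossing: since both tensions at `γ` equal `t`, the area depends on `γ` through its cut area.
Replacing `γ` by `γ ∪ rC` does not raise this, by submodularity and the minimality of `rC` against
`γ ∩ rC`, and shrinking `α` and `β` does not enlarge their interface. -/
theorem exists_isMinTriwayCut_superset (hw : ∀ e ∈ G.edgeSet, 0 ≤ w e) (hAB : Disjoint A B)
    (hBC : Disjoint B C) (hCA : Disjoint C A) {tAB t : ℝ} (htAB : 0 ≤ tAB) (ht : 0 ≤ t) {rC : Set V}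
    (hr : IsMinCut G w C (A ∪ B) rC) :
    ∃ α β γ, IsMinTriwayCut G w tAB t t A B C α β γ ∧ rC ⊆ γ := by
  classical
  obtain ⟨⟨α, β, γ, hcut, hval⟩, hle⟩ :=
    isLeast_minTriwayCut (G := G) (w := w) hAB hBC hCA tAB t t
  obtain ⟨hU, h1, h2, h3, hA, hB, hC⟩ := hcut
  obtain ⟨hCr, hABr⟩ := hr.1
  have harea : ∀ {α β γ : Set V}, α ∪ β ∪ γ = Set.univ → Disjoint α β → Disjoint β γ →
      Disjoint γ α → triwayArea G w tAB t t α β γ =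
        tAB * weight G w (cutSurface G α β) + t * cutArea G w γ := by
    intro α β γ hU h1 h2 h3
    rw [triwayArea_eq, weight_cutSurface, cutArea_eq, mul_edgeSum, mul_edgeSum, ← edgeSum_add]
    refine edgeSum_congr fun x y hxy => ?_
    simp only [cutIndicator, mem_cutSurface hxy, Set.mem_compl_iff]
    rcases triway_cases hU h1 h2 h3 x with ⟨x1, x2, x3⟩ | ⟨x1, x2, x3⟩ | ⟨x1, x2, x3⟩ <;>
      rcases triway_cases hU h1 h2 h3 y with ⟨y1, y2, y3⟩ | ⟨y1, y2, y3⟩ | ⟨y1, y2, y3⟩ <;>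
      simp [x1, x2, x3, y1, y2, y3, mul_comm]
  have hcut' : IsTriwayCut A B C (α \ rC) (β \ rC) (γ ∪ rC) := by
    refine ⟨?_, h1.mono Set.sdiff_subset Set.sdiff_subset, ?_, ?_, ?_, ?_,
      hC.trans Set.subset_union_left⟩
    · ext x
      have hx : x ∈ α ∪ β ∪ γ := hU ▸ Set.mem_univ x
      simp only [Set.mem_union, Set.mem_sdiff, Set.mem_univ, iff_true] at hx ⊢
      tauto
    · exact Disjoint.union_right (h2.mono_left Set.sdiff_subset) Set.disjoint_sdiff_left
    · exact Disjoint.union_left (h3.mono_right Set.sdiff_subset) Set.disjoint_sdiff_right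
    · exact fun x hx => ⟨hA hx, hABr (Or.inl hx)⟩
    · exact fun x hx => ⟨hB hx, hABr (Or.inr hx)⟩
  refine ⟨_, _, _, ⟨hcut', fun α' β' γ' h' => le_trans ?_ (hle ⟨α', β', γ', h', rfl⟩)⟩,
    Set.subset_union_right⟩
  rw [← hval, harea hU h1 h2 h3, harea hcut'.1 hcut'.2.1 hcut'.2.2.1 hcut'.2.2.2.1]
  have hsub := cutArea_submodular hw γ rC
  have hmin := hr.2 (γ ∩ rC) ⟨Set.subset_inter hC hCr, fun x hx => fun h => hABr hx h.2⟩
  have h4 : weight G w (cutSurface G (α \ rC) (β \ rC)) ≤ weight G w (cutSurface G α β) := by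
    rw [weight_cutSurface, weight_cutSurface]
    refine edgeSum_weight_mono hw fun x y hxy => ?_
    simp only [cutIndicator, mem_cutSurface hxy, Set.mem_sdiff]
    split_ifs <;> first | exact le_rfl | exact zero_le_one | (exfalso; tauto)
  exact add_le_add (mul_le_mul_of_nonneg_left h4 htAB)
    (mul_le_mul_of_nonneg_left (by linarith) ht)

/-- The distances among `g_A`, `g_B` and `X` are at most the tensions. Reaching `id` goes through
`X` and costs a further `n(m-2)`, which is charged to the boundary of `rC`. -/
theorem rObjective_cutConfig_le (hw : ∀ e ∈ G.edgeSet, 0 ≤ w e) (hn : 2 ≤ n) (hm : 2 ≤ m)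
    (hm' : Even m) {α β γ rC : Set V} (hcut : IsTriwayCut A B C α β γ) (hr : rC ⊆ γ) :
    RObjective G w (cutConfig n m α β rC) ≤
      triwayArea G w (2 * ((n : ℝ) - 1)) n n α β γ + n * ((m : ℝ) - 2) * cutArea G w rC := by
  classical
  obtain ⟨hU, h1, h2, h3, -, -, -⟩ := hcut
  have dAB : (cayleyDist (gA n m) (gB n m) : ℝ) ≤ 2 * ((n : ℝ) - 1) := by
    exact_mod_cast cayleyDist_gA_gB_le hn hm hm'
  have dAX : (cayleyDist (gA n m) (gX n m) : ℝ) ≤ n := by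
    exact_mod_cast cayleyDist_gA_gX_le hm hm'
  have dBX : (cayleyDist (gB n m) (gX n m) : ℝ) ≤ n := by
    exact_mod_cast cayleyDist_gB_gX_le hm hm'
  have dX1 : (cayleyDist (gX n m) 1 : ℝ) ≤ n * ((m : ℝ) - 2) := by
    exact_mod_cast (cayleyDist_gX_one hm hm').le
  have dA1 : (cayleyDist (gA n m) 1 : ℝ) ≤ n + n * ((m : ℝ) - 2) := by
    exact_mod_cast cayleyDist_gA_one_le hm hm'
  have dB1 : (cayleyDist (gB n m) 1 : ℝ) ≤ n + n * ((m : ℝ) - 2) := by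
    exact_mod_cast cayleyDist_gB_one_le hm hm'
  have dBA := dAB
  have dXA := dAX
  have dXB := dBX
  have d1X := dX1
  have d1A := dA1
  have d1B := dB1
  rw [cayleyDist_comm] at dBA dXA dXB d1X d1A d1B
  rw [triwayArea_eq, cutArea_eq, mul_edgeSum, ← edgeSum_add, RObjective]
  have heq : ∀ e, w e * (2 * ((n : ℝ) - 1) * cutIndicator G α β e + n * cutIndicator G β γ e +
      n * cutIndicator G γ α e) + n * ((m : ℝ) - 2) * (w e * cutIndicator G rC rCᶜ e) =
      w e * (2 * ((n : ℝ) - 1) * cutIndicator G α β e + n * cutIndicator G β γ e +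
      n * cutIndicator G γ α e + n * ((m : ℝ) - 2) * cutIndicator G rC rCᶜ e) := fun e => by ring
  simp only [heq]
  refine edgeSum_weight_mono hw fun x y hxy => ?_
  rw [Sym2.lift_mk]
  have hclass : ∀ x, (x ∈ α ∧ x ∉ β ∧ x ∉ γ ∧ x ∉ rC) ∨ (x ∉ α ∧ x ∈ β ∧ x ∉ γ ∧ x ∉ rC) ∨
      (x ∉ α ∧ x ∉ β ∧ x ∈ γ ∧ x ∉ rC) ∨ (x ∉ α ∧ x ∉ β ∧ x ∈ γ ∧ x ∈ rC) := by
    intro x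
    have h4 := @hr x
    have h5 := triway_cases hU h1 h2 h3 x
    tauto
  simp only [cutIndicator, mem_cutSurface hxy, Set.mem_compl_iff]
  rcases hclass x with ⟨x1, x2, x3, x4⟩ | ⟨x1, x2, x3, x4⟩ | ⟨x1, x2, x3, x4⟩ | ⟨x1, x2, x3, x4⟩ <;>
    rcases hclass y with ⟨y1, y2, y3, y4⟩ | ⟨y1, y2, y3, y4⟩ | ⟨y1, y2, y3, y4⟩ | ⟨y1, y2, y3, y4⟩ <;>
    simp only [cutConfig, x1, x2, x3, x4, y1, y2, y3, y4, if_true, if_false, cayleyDist_self,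
      Int.cast_zero, or_self, or_false, or_true, and_true, and_false, not_true_eq_false, not_false_eq_true, mul_zero, mul_one, add_zero, zero_add,
      le_refl] <;> linarith

/-- On every edge the surplus of the Cayley distance over the coarsened distance dominates the
change of the rank defect, a potential that drops by `n(m-2)` from `A ∪ B` to `C`. -/
theorem qObjective_add_le_rObjective (hw : ∀ e ∈ G.edgeSet, 0 ≤ w e) (hm : 2 ≤ m) (hm' : Even m)
    {g : V → ReplicaPerm n m} (hg : RFeasible n m A B C g) :
    QObjective G w (fun x => coarsen (gX n m) (g x)) +
      n * ((m : ℝ) - 2) * minCut G w (A ∪ B) C ≤ RObjective G w g := by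
  obtain ⟨hA, hB, hC⟩ := hg
  have hnonneg : ∀ p : Setoid (Fin n × Fin m), 0 ≤ rankDefect (gX n m) p := fun p => by
    rw [← rankDefect_bot (gX n m)]
    exact rankDefect_mono _ bot_le
  let f : V → ℕ := fun x => (rankDefect (gX n m) (cyclePartition (g x))).toNat
  have hf : ∀ x, (f x : ℤ) = rankDefect (gX n m) (cyclePartition (g x)) := fun x =>
    Int.toNat_of_nonneg (hnonneg _)
  have key := mul_minCut_le (G := G) hw (S := A ∪ B) (T := C) (K := n * (m - 2)) (f := f) ?_ ?_
    (d := fun e =>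
      ((Sym2.lift ⟨fun x y => cayleyDist (g x) (g y), fun x y => cayleyDist_comm (g x) (g y)⟩ e : ℤ) : ℝ) -
      (Sym2.lift ⟨fun x y => partitionDist (coarsen (gX n m) (g x)) (coarsen (gX n m) (g y)),
        fun _ _ => partitionDist_comm _ _⟩ e : ℤ)) ?_
  · rw [Nat.cast_mul, Nat.cast_sub hm, Nat.cast_two] at key
    refine (add_le_add_right key _).trans (le_of_eq ?_)
    rw [QObjective, RObjective, ← edgeSum_add]
    congr 1
    ext e
    ring
  · intro x hx
    have h : rankDefect (gX n m) (cyclePartition (g x)) = n * (m - 2) := by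
      rcases hx with hx | hx
      · rw [hA x hx, rankDefect_gA hm hm']
      · rw [hB x hx, rankDefect_gB hm hm']
    have h' := hf x
    rw [h] at h'
    zify [hm]
    exact h'
  · intro x hx
    have h' := hf x
    rw [hC x hx, cyclePartition_one, rankDefect_bot] at h'
    exact_mod_cast h'
  · intro x y _
    have h := partitionDist_coarsen_add_le (gX n m) (g x) (g y)
    rw [← hf, ← hf] at h
    simp only [Sym2.lift_mk]
    rw [le_sub_iff_add_le, add_comm]
    exact_mod_cast h

theorem isLeast_R (hAB : Disjoint A B) (hBC : Disjoint B C) (hCA : Disjoint C A) :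
    IsLeast (RValues n m G w A B C) (R n m G w A B C) := by
  refine isLeast_sInf_of_finite ?_ ?_
  · exact (Set.finite_range (RObjective (n := n) (m := m) G w)).subset fun _ ⟨g, _, h⟩ => ⟨g, h⟩
  · obtain ⟨⟨α, β, γ, hcut, -⟩, -⟩ := isLeast_minTriwayCut (G := G) (w := w) hAB hBC hCA 0 0 0
    exact ⟨_, _, rFeasible_cutConfig hcut subset_rfl hcut.2.2.2.2.2.2, rfl⟩

theorem isLeast_Q (hAB : Disjoint A B) (hBC : Disjoint B C) (hCA : Disjoint C A) :
    IsLeast (QValues n m G w A B C) (Q n m G w A B C) := by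
  refine isLeast_sInf_of_finite ?_ ?_
  · have : Finite (BlockPartition n m) :=
      Finite.of_injective (fun s : BlockPartition n m => (s : _ → _ → Prop)) fun _ _ h =>
        Setoid.eq_iff_rel_eq.2 h
    exact (Set.finite_range (QObjective (n := n) (m := m) G w)).subset fun _ ⟨q, _, h⟩ => ⟨q, h⟩
  · obtain ⟨⟨g, hg, -⟩, -⟩ := isLeast_R (n := n) (m := m) (G := G) (w := w) hAB hBC hCA
    exact ⟨_, _, qFeasible_coarsen hg, rfl⟩

theorem isLeast_BoolOptAt (hw : ∀ e ∈ G.edgeSet, 0 ≤ w e) (hAB : Disjoint A B)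
    (b : V → Fin (2 * n) → Bool) :
    IsLeast (BoolValuesAt n G w A B b) (BoolOptAt n G w A B b) :=
  isLeast_sInf_image (edgeSum_monotone hw) (s := {r | BoolConstraints n G A B b r})
    (exists_boolConstraints_of hAB n b)

theorem boolValues_finite : (BoolValues n G w A B C).Finite :=
  (Set.finite_range (BoolOptAt n G w A B)).subset fun _ ⟨b, _, h⟩ => ⟨b, h⟩

theorem isLeast_BoolOpt (hAC : Disjoint (A ∪ B) C) :
    IsLeast (BoolValues n G w A B C) (BoolOpt n G w A B C) := by
  classical
  refine isLeast_sInf_of_finite boolValues_finite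
    ⟨_, fun x => if x ∈ A ∪ B then ⊤ else ⊥, ⟨fun x hx => ?_, fun x hx => ?_, fun x hx => ?_⟩, rfl⟩
  · exact if_pos (Or.inl hx)
  · exact if_pos (Or.inr hx)
  · exact if_neg (Set.disjoint_right.1 hAC hx)

theorem boolOpt_le_Q (hw : ∀ e ∈ G.edgeSet, 0 ≤ w e) (hAB : Disjoint A B) (hBC : Disjoint B C)
    (hCA : Disjoint C A) (hn : 2 ≤ n) (hm : 2 ≤ m) (hm' : Even m) :
    BoolOpt n G w A B C ≤ Q n m G w A B C := by
  obtain ⟨⟨q, hq, hval⟩, -⟩ := isLeast_Q (n := n) (m := m) (G := G) (w := w) hAB hBC hCA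
  obtain ⟨b, r, hb, hr, hrq⟩ := exists_boolConstraints (G := G) hn hm hm' hq
  rw [← hval]
  calc BoolOpt n G w A B C ≤ BoolOptAt n G w A B b :=
        csInf_le boolValues_finite.bddBelow ⟨b, hb, rfl⟩
    _ ≤ edgeSum G (fun e => w e * r e) := (isLeast_BoolOptAt hw hAB b).2 ⟨r, hr, rfl⟩
    _ ≤ QObjective G w q := edgeSum_weight_mono hw fun x y _ => by
        rw [Sym2.lift_mk]
        exact_mod_cast (hrq x y).le

theorem exists_intValue_eq_boolOpt (hw : ∀ e ∈ G.edgeSet, 0 ≤ w e) (hAB : Disjoint A B)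
    (hAC : Disjoint (A ∪ B) C) : BoolOpt n G w A B C ∈ IntValues n G w A B C := by
  obtain ⟨⟨b, hb, hval⟩, -⟩ := isLeast_BoolOpt (n := n) (G := G) (w := w) hAC
  obtain ⟨⟨r, hr, hval'⟩, -⟩ := isLeast_BoolOptAt (n := n) (G := G) hw hAB b
  obtain ⟨ρ, σ, h, hadd⟩ := exists_intConstraints hb hr
  have hadd' : ∀ x y, G.Adj x y → (σ s(x, y) : ℝ) + ρ s(x, y) = r s(x, y) := fun x y hxy => by
    exact_mod_cast hadd x y hxy
  refine ⟨ρ, σ, h, ?_⟩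
  rw [← hval, ← hval']
  exact le_antisymm (edgeSum_weight_mono hw fun x y hxy => (hadd' x y hxy).le)
    (edgeSum_weight_mono hw fun x y hxy => (hadd' x y hxy).ge)

theorem isLeast_IntOpt (hw : ∀ e ∈ G.edgeSet, 0 ≤ w e) (hAB : Disjoint A B)
    (hAC : Disjoint (A ∪ B) C) : IsLeast (IntValues n G w A B C) (IntOpt n G w A B C) := by
  have himage : IntValues n G w A B C =
      (fun p : (Sym2 V → ℕ) × (Sym2 V → ℕ) => edgeSum G fun e => w e * ((p.2 e : ℝ) + p.1 e)) ''
        {p | IntConstraints n G A B C p.1 p.2} := by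
    ext c
    constructor
    · rintro ⟨ρ, σ, h, rfl⟩
      exact ⟨(ρ, σ), h, rfl⟩
    · rintro ⟨p, h, rfl⟩
      exact ⟨p.1, p.2, h, rfl⟩
  have hmono : Monotone fun p : (Sym2 V → ℕ) × (Sym2 V → ℕ) =>
      edgeSum G fun e => w e * ((p.2 e : ℝ) + p.1 e) := fun p p' h =>
    edgeSum_weight_mono hw fun x y _ => by
      exact_mod_cast add_le_add (h.2 s(x, y)) (h.1 s(x, y))
  have hne := exists_intValue_eq_boolOpt (n := n) hw hAB hAC
  rw [IntOpt, himage]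
  rw [himage] at hne
  exact isLeast_sInf_image hmono (Set.image_nonempty.1 ⟨_, hne⟩)

theorem minTriwayCut_le_intOpt (hw : ∀ e ∈ G.edgeSet, 0 ≤ w e) (hAB : Disjoint A B)
    (hBC : Disjoint B C) (hCA : Disjoint C A) (hAC : Disjoint (A ∪ B) C) (hn : 2 ≤ n) :
    minTriwayCut G w (2 * ((n : ℝ) - 1)) n n A B C ≤ IntOpt n G w A B C := by
  obtain ⟨⟨ρ, σ, h, hval⟩, -⟩ := isLeast_IntOpt (n := n) hw hAB hAC
  obtain ⟨α, β, γ, hcut, hle⟩ := exists_triwayCut_le hw hn h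
  rw [← hval]
  exact ((isLeast_minTriwayCut hAB hBC hCA _ _ _).2 ⟨α, β, γ, hcut, rfl⟩).trans hle

end Comparison

end TriwayCut

/-! ### The main theorem -/

theorem mainTheorem3 {V : Type*} [Fintype V] (G : SimpleGraph V) (w : Sym2 V → ℝ)
    (hw : ∀ e ∈ G.edgeSet, 0 ≤ w e) (A B C : Set V)
    (hAB : Disjoint A B) (hBC : Disjoint B C) (hCA : Disjoint C A)
    (n m : ℕ) (hn : 2 ≤ n) (hm : 2 ≤ m) (hm_even : Even m) :
    -- every optimal value is an attained minimum
    (IsLeast (TriwayCut.RValues n m G w A B C) (TriwayCut.R n m G w A B C) ∧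
      IsLeast (TriwayCut.QValues n m G w A B C) (TriwayCut.Q n m G w A B C) ∧
      (∀ b, TriwayCut.BoolFeasible n A B C b →
        IsLeast (TriwayCut.BoolValuesAt n G w A B b) (TriwayCut.BoolOptAt n G w A B b)) ∧
      IsLeast (TriwayCut.BoolValues n G w A B C) (TriwayCut.BoolOpt n G w A B C) ∧
      IsLeast (TriwayCut.IntValues n G w A B C) (TriwayCut.IntOpt n G w A B C) ∧
      IsLeast (TriwayCut.cutValues G w (A ∪ B) C) (TriwayCut.minCut G w (A ∪ B) C) ∧
      IsLeast (TriwayCut.triwayValues G w (2 * ((n : ℝ) - 1)) n n A B C)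
        (TriwayCut.minTriwayCut G w (2 * ((n : ℝ) - 1)) n n A B C)) ∧
    -- the optimal values agree
    (TriwayCut.R n m G w A B C - n * ((m : ℝ) - 2) * TriwayCut.minCut G w (A ∪ B) C
        = TriwayCut.Q n m G w A B C ∧
      TriwayCut.Q n m G w A B C = TriwayCut.BoolOpt n G w A B C ∧
      TriwayCut.BoolOpt n G w A B C = TriwayCut.IntOpt n G w A B C ∧
      TriwayCut.IntOpt n G w A B C
        = TriwayCut.minTriwayCut G w (2 * ((n : ℝ) - 1)) n n A B C) ∧
    -- the optimum of `R` is attained on the regions of cuts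
    ∀ rC, TriwayCut.IsMinCut G w C (A ∪ B) rC →
      (∃ α β γ, TriwayCut.IsMinTriwayCut G w (2 * ((n : ℝ) - 1)) n n A B C α β γ ∧ rC ⊆ γ) ∧
      ∀ α β γ, TriwayCut.IsMinTriwayCut G w (2 * ((n : ℝ) - 1)) n n A B C α β γ → rC ⊆ γ →
        TriwayCut.RFeasible n m A B C (TriwayCut.cutConfig n m α β rC) ∧
        TriwayCut.RObjective G w (TriwayCut.cutConfig (V := V) n m α β rC)
          = TriwayCut.R n m G w A B C := by
  have hAC : Disjoint (A ∪ B) C := Disjoint.union_left hCA.symm hBC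
  have hn' : (2 : ℝ) ≤ n := by exact_mod_cast hn
  have hR := TriwayCut.isLeast_R (n := n) (m := m) (G := G) (w := w) hAB hBC hCA
  have hQ := TriwayCut.isLeast_Q (n := n) (m := m) (G := G) (w := w) hAB hBC hCA
  have hI := TriwayCut.isLeast_IntOpt (n := n) hw hAB hAC
  have hT := TriwayCut.isLeast_minTriwayCut (G := G) (w := w) hAB hBC hCA (2 * ((n : ℝ) - 1)) n n
  have hexists : ∀ rC, TriwayCut.IsMinCut G w C (A ∪ B) rC →
      ∃ α β γ, TriwayCut.IsMinTriwayCut G w (2 * ((n : ℝ) - 1)) n n A B C α β γ ∧ rC ⊆ γ :=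
    fun rC => TriwayCut.exists_isMinTriwayCut_superset hw hAB hBC hCA (by linarith) (by linarith)
  have hconfig : ∀ rC, TriwayCut.IsMinCut G w C (A ∪ B) rC → ∀ α β γ,
      TriwayCut.IsMinTriwayCut G w (2 * ((n : ℝ) - 1)) n n A B C α β γ → rC ⊆ γ →
        TriwayCut.RFeasible n m A B C (TriwayCut.cutConfig n m α β rC) ∧
        TriwayCut.RObjective G w (TriwayCut.cutConfig (V := V) n m α β rC) ≤
          TriwayCut.minTriwayCut G w (2 * ((n : ℝ) - 1)) n n A B C +
            n * ((m : ℝ) - 2) * TriwayCut.minCut G w (A ∪ B) C := by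
    intro rC hr α β γ hcut hsub
    refine ⟨TriwayCut.rFeasible_cutConfig hcut.1 hr.1.1 hsub,
      (TriwayCut.rObjective_cutConfig_le hw hn hm hm_even hcut.1 hsub).trans ?_⟩
    obtain ⟨α', β', γ', hcut', hval⟩ := hT.1
    rw [hr.area_eq, ← hval]
    exact add_le_add_left (hcut.2 _ _ _ hcut') _
  have hRQ : TriwayCut.Q n m G w A B C + n * ((m : ℝ) - 2) * TriwayCut.minCut G w (A ∪ B) C ≤
      TriwayCut.R n m G w A B C := by
    obtain ⟨g, hg, hval⟩ := hR.1
    rw [← hval]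
    exact (add_le_add_left (hQ.2 ⟨_, TriwayCut.qFeasible_coarsen hg, rfl⟩) _).trans
      (TriwayCut.qObjective_add_le_rObjective hw hm hm_even hg)
  have hQB := TriwayCut.boolOpt_le_Q (n := n) (m := m) hw hAB hBC hCA hn hm hm_even
  have hBI := hI.2 (TriwayCut.exists_intValue_eq_boolOpt (n := n) hw hAB hAC)
  have hIT := TriwayCut.minTriwayCut_le_intOpt hw hAB hBC hCA hAC hn
  have hTR : TriwayCut.R n m G w A B C ≤
      TriwayCut.minTriwayCut G w (2 * ((n : ℝ) - 1)) n n A B C +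
        n * ((m : ℝ) - 2) * TriwayCut.minCut G w (A ∪ B) C := by
    obtain ⟨rC, hr⟩ := TriwayCut.exists_isMinCut (G := G) (w := w) hAC.symm
    obtain ⟨α, β, γ, hcut, hsub⟩ := hexists rC hr
    obtain ⟨h1, h2⟩ := hconfig rC hr α β γ hcut hsub
    exact (hR.2 ⟨_, h1, rfl⟩).trans h2
  -- `hRQ`, `hQB`, `hBI`, `hIT` and `hTR` close a cycle of inequalities, so all of them are
  -- equalities, and the upper bound in `hconfig` is the optimal value `R`.
  refine ⟨⟨hR, hQ, fun b _ => TriwayCut.isLeast_BoolOptAt hw hAB b, TriwayCut.isLeast_BoolOpt hAC,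
    hI, TriwayCut.isLeast_minCut hAC, hT⟩, ⟨?_, ?_, ?_, ?_⟩, fun rC hr => ⟨hexists rC hr, ?_⟩⟩
  · linarith
  · linarith
  · linarith
  · linarith
  · intro α β γ hcut hsub
    obtain ⟨h1, h2⟩ := hconfig rC hr α β γ hcut hsub
    exact ⟨h1, le_antisymm (by linarith) (hR.2 ⟨_, h1, rfl⟩)⟩
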